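/- A probability algebra (a model of the theory $Pr$) is a Boolean algebra $\mathcal B$ with a finitely additive probability measure $\mu$ such that $d(a,b)=\mu(a\triangle b)$ is a complete metric on $\mathcal B$; equivalently, $\mathcal B$ is $\sigma$-complete and $\mu$ is a strictly positive $\sigma$-additive probability measure on it. An isomorphism of probability algebras is a measure-preserving Boolean isomorphism. An element $b\in\mathcal B$ is atomless if every nonzero $a\le b$ is the join of two disjoint nonzero elements. The density of $b$ is the least cardinality of a $d$-dense subset of $\{a\in\mathcal B: a\le b\}$, and $b$ is homogeneous if $b\ne 0$ and every nonzero $a\le b$ has the same density as $b$. The algebra $\mathcal B$ is called atomless (homogeneous) if $1$ is, and its density is that of $1$. The atomic part of $\mathcal B$ is the join $a_0$ of its atoms; the atomless part is the complement $a_0^c$. For a probability algebra $\mathcal M=(\mathcal B,\mu,d)$ let - $\Phi^{\mathcal M}=(t_n)_{n\ge1}$ be the sequence of the measures of the atoms of $\mathcal B$, listed in decreasing order with multiplicity and followed by zeros if there are only finitely many atoms; - $\mathcal K^{\mathcal M}$ be the set of all infinite cardinals $\kappa$ for which there is an atomless homogeneous $b\in\mathcal B$ of density $\kappa$; - $\Psi^{\mathcal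 M}(\kappa)=\sup\{\mu(b) : b \text{ atomless and homogeneous of density } \kappa\}$ for $\kappa\in\mathcal K^{\mathcal M}$. **Theorem (Maharam).** (1) For every probability algebra $\mathcal M$, the atomic part $a_0$ exists, the set $\mathcal K^{\mathcal M}$ is countable, $\Psi^{\mathcal M}$ takes values in $(0,1]$, $\sum_{n}t_n=\mu(a_0)$ and $\sum_{\kappa\in\mathcal K^{\mathcal M}}\Psi^{\mathcal M}(\kappa)=\mu(a_0^c)$. (2) Every probability algebra is determined up to isomorphism by its invariants: probability algebras $\mathcal M$ and $\mathcal N$ are isomorphic if and only if $\Phi^{\mathcal M}=\Phi^{\mathcal N}$, $\mathcal K^{\mathcal M}=\mathcal K^{\mathcal N}$ and $\Psi^{\mathcal M}=\Psi^{\mathcal N}$. (3) In particular, two homogeneous atomless probability algebras with the same density are isomorphic. -/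

import Mathlib

open scoped Cardinal symmDiff

universe u

/-- A probability algebra, i.e. a model of the theory `Pr`: a Boolean algebra `B` with a finitely
additive probability measure `μ` such that `d(a, b) = μ(a ∆ b)` is a complete metric on `B`.
(Strict positivity of `μ`, `σ`-completeness of `B` and `σ`-additivity of `μ` are consequences.) -/
class ProbabilityAlgebra (B : Type u) extends BooleanAlgebra B, MetricSpace B, CompleteSpace B where
  /-- the measure -/
  μ : B → ℝ
  μ_bot : μ ⊥ = 0
  μ_top : μ ⊤ = 1
  μ_inf_le : ∀ x y : B, μ (x ⊓ y) ≤ μ x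
  μ_le_sup : ∀ x y : B, μ x ≤ μ (x ⊔ y)
  μ_sub_inf : ∀ x y : B, μ x - μ (x ⊓ y) = μ (x ⊔ y) - μ y
  dist_eq_μ : ∀ x y : B, dist x y = μ (x ∆ y)

namespace ProbabilityAlgebra

/-- Isomorphism of probability algebras: a bijection which preserves the Boolean structure and
the measure (hence also the metric). -/
def Isomorphic (B C : Type u) [ProbabilityAlgebra B] [ProbabilityAlgebra C] : Prop :=
  ∃ e : B ≃o C, ∀ a : B, μ (e a) = μ a

/-- The density of a topological space: the least cardinality of a dense subset. -/
noncomputable def density (X : Type u) [TopologicalSpace X] : Cardinal.{u} :=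
  sInf {κ | ∃ s : Set X, Dense s ∧ #s = κ}

variable {B : Type u} [ProbabilityAlgebra B]

/-- The density of an element `b`: the metric density of the ideal `{a | a ≤ b}`. -/
noncomputable def eltDensity (b : B) : Cardinal.{u} := density (Set.Iic b)

/-- `b` is atomless if each nonzero `a ≤ b` splits into two disjoint nonzero pieces. -/
def IsAtomless (b : B) : Prop :=
  ∀ a ≤ b, a ≠ ⊥ → ∃ a₁ a₂ : B, a₁ ≠ ⊥ ∧ a₂ ≠ ⊥ ∧ Disjoint a₁ a₂ ∧ a₁ ⊔ a₂ = a

/-- `b` is homogeneous if `b ≠ 0` and all nonzero `a ≤ b` have the same density as `b`. -/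
def IsHomogeneous (b : B) : Prop :=
  b ≠ ⊥ ∧ ∀ a ≤ b, a ≠ ⊥ → eltDensity a = eltDensity b

/-- `a₀` is the atomic part of `B`: the join of all atoms. -/
def IsAtomicPart (a₀ : B) : Prop := IsLUB {a : B | IsAtom a} a₀

variable (B)

/-- The atom-size invariant: `atomSizes B n` is the `(n+1)`-st largest measure of an atom of `B`,
counted with multiplicity, and `0` if `B` has at most `n` atoms.  It is the largest `r` such that
`r = 0` or there are `n + 1` distinct atoms of measure at least `r`. -/
noncomputable def atomSizes (n : ℕ) : ℝ :=
  sSup (insert 0 {r : ℝ | ∃ s : Finset B, s.card = n + 1 ∧ ∀ a ∈ s, IsAtom a ∧ r ≤ μ a})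

/-- The measures of the homogeneous elements of density `κ` in the atomless part of `B`. -/
def homogeneousMeasures (κ : Cardinal.{u}) : Set ℝ :=
  {r | ∃ b : B, IsAtomless b ∧ IsHomogeneous b ∧ eltDensity b = κ ∧ μ b = r}

/-- The first Maharam invariant: the set of infinite cardinals which are the density of some
homogeneous element of the atomless part of `B`. -/
def maharamK : Set Cardinal.{u} :=
  {κ | ℵ₀ ≤ κ ∧ ∃ b : B, IsAtomless b ∧ IsHomogeneous b ∧ eltDensity b = κ}

/-- The second Maharam invariant: the supremum of the measures of homogeneous elements of
density `κ` in the atomless part of `B` (only used for `κ ∈ maharamK B`). -/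
noncomputable def maharamΨ (κ : Cardinal.{u}) : ℝ := sSup (homogeneousMeasures B κ)

end ProbabilityAlgebra

open ProbabilityAlgebra

/-! The heart is the homogeneous case, `exists_orderIso_of_homogeneous`. The isomorphism comes from
a transfinite back-and-forth along dense sets of size at most `κ`. Each stage is a
measure-preserving isomorphism between subalgebras with fewer than `κ` elements, stored as its graph
in `A × C`. To extend it to a new `a`, one needs `c` in the other algebra such that `ms (c ⊓ d)` is
a prescribed additive functional of `d`, where `d` runs over the closure `D` of the range. Since `D`
has a dense subset of fewer than `κ` elements while every nonzero principal ideal has density at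
least `κ`, no such ideal is the trace of `D`. Under this condition a Hahn decomposition argument,
`RelativelyAtomless.exists_ms_inf_eq`, realises every additive functional between `0` and the
measure: a Radon–Nikodym theorem whose derivative is given by an element of the algebra.

The general case follows by cutting and gluing. Completeness yields arbitrary joins and complete
additivity. Cardinals are well-ordered, so every nonzero element contains a homogeneous one, and the
atomless part is the join of the parts `homogeneousPart B κ`. Bounds on density survive joins and
limits, so each part is itself homogeneous (`eltDensity_of_le_homogeneousPart`), and distinct parts
are disjoint. Together with the atoms they form a partition of unity whose pieces are classified by
measure and density; `exists_orderIso_of_partition` glues the isomorphisms of the pieces. The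
setting is finite measure algebras, not only probability algebras, so that principal ideals are
included. -/

/-- A Boolean algebra with a metric which comes from a finitely additive finite measure, namely
from the distance to `⊥`. -/
class MeasureAlgebra (B : Type*) [BooleanAlgebra B] [MetricSpace B] : Prop where
  dist_eq' : ∀ x y : B, dist x y = dist (x ⊔ y) ⊥ - dist (x ⊓ y) ⊥
  modular' : ∀ x y : B, dist (x ⊔ y) ⊥ + dist (x ⊓ y) ⊥ = dist x ⊥ + dist y ⊥

namespace MeasureAlgebra

open Filter Topology

/-- The measure of an element of a measure algebra: its distance to `⊥`. -/
def ms {B : Type*} [BooleanAlgebra B] [MetricSpace B] (b : B) : ℝ := dist b ⊥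

/-! ### Metric measure algebras: continuity, joins, complete additivity -/

section Basic

variable {B : Type*} [BooleanAlgebra B] [MetricSpace B] [MeasureAlgebra B]

theorem dist_eq_sub (x y : B) : dist x y = ms (x ⊔ y) - ms (x ⊓ y) := dist_eq' x y

theorem ms_sup_add_inf (x y : B) : ms (x ⊔ y) + ms (x ⊓ y) = ms x + ms y := modular' x y

omit [MeasureAlgebra B] in
@[simp] theorem ms_bot : ms (⊥ : B) = 0 := dist_self _

omit [MeasureAlgebra B] in
theorem ms_nonneg (x : B) : 0 ≤ ms x := dist_nonneg

omit [MeasureAlgebra B] in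
theorem ms_eq_zero {x : B} : ms x = 0 ↔ x = ⊥ := dist_eq_zero

omit [MeasureAlgebra B] in
theorem ms_pos {x : B} : 0 < ms x ↔ x ≠ ⊥ := dist_pos

theorem ms_sup_of_disjoint {x y : B} (h : Disjoint x y) : ms (x ⊔ y) = ms x + ms y := by
  have := ms_sup_add_inf x y
  rw [h.eq_bot, ms_bot] at this
  linarith

theorem ms_inf_add_sdiff (x y : B) : ms (x ⊓ y) + ms (x \ y) = ms x := by
  rw [← ms_sup_of_disjoint disjoint_inf_sdiff, sup_inf_sdiff]

theorem ms_mono {x y : B} (h : x ≤ y) : ms x ≤ ms y := by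
  have := ms_inf_add_sdiff y x
  rw [inf_eq_right.2 h] at this
  linarith [ms_nonneg (y \ x)]

theorem ms_sdiff {x y : B} (h : x ≤ y) : ms (y \ x) = ms y - ms x := by
  have := ms_inf_add_sdiff y x
  rw [inf_eq_right.2 h] at this
  linarith

theorem ms_sup_le (x y : B) : ms (x ⊔ y) ≤ ms x + ms y := by
  linarith [ms_sup_add_inf x y, ms_nonneg (x ⊓ y)]

theorem dist_eq_sdiff (x y : B) : dist x y = ms (x \ y) + ms (y \ x) := by
  have h1 := ms_inf_add_sdiff x y
  have h2 := ms_inf_add_sdiff y x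
  rw [inf_comm] at h2
  have h3 := ms_sup_add_inf x y
  rw [dist_eq_sub]
  linarith

theorem dist_of_le {x y : B} (h : x ≤ y) : dist x y = ms y - ms x := by
  rw [dist_eq_sub, sup_eq_right.2 h, inf_eq_left.2 h]

theorem dist_sup_sup_le (x y x' y' : B) : dist (x ⊔ y) (x' ⊔ y') ≤ dist x x' + dist y y' := by
  have key : ∀ x y x' y' : B, ms ((x ⊔ y) \ (x' ⊔ y')) ≤ ms (x \ x') + ms (y \ y') := by
    intro x y x' y'
    refine (ms_mono ?_).trans (ms_sup_le (x \ x') (y \ y'))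
    rw [sup_sdiff]
    exact sup_le_sup (sdiff_le_sdiff_left le_sup_left) (sdiff_le_sdiff_left le_sup_right)
  simp only [dist_eq_sdiff]
  linarith [key x y x' y', key x' y' x y]

theorem dist_compl (x y : B) : dist xᶜ yᶜ = dist x y := by
  simp only [dist_eq_sdiff, compl_sdiff_compl]
  ring

theorem dist_inf_inf_le (x y x' y' : B) : dist (x ⊓ y) (x' ⊓ y') ≤ dist x x' + dist y y' := by
  rw [← dist_compl (x ⊓ y), compl_inf, compl_inf, ← dist_compl x, ← dist_compl y]
  exact dist_sup_sup_le _ _ _ _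

theorem dist_le_dist_inf (x y z : B) : dist (x ⊓ z) (y ⊓ z) ≤ dist x y := by
  simpa using dist_inf_inf_le x z y z

instance : ContinuousSup B where
  continuous_sup := by
    refine (LipschitzWith.of_dist_le_mul (K := 2) fun p q ↦ ?_).continuous
    refine (dist_sup_sup_le p.1 p.2 q.1 q.2).trans ?_
    have h1 : dist p.1 q.1 ≤ dist p q := le_max_left _ _
    have h2 : dist p.2 q.2 ≤ dist p q := le_max_right _ _
    norm_num
    linarith

instance : ContinuousInf B where
  continuous_inf := by
    refine (LipschitzWith.of_dist_le_mul (K := 2) fun p q ↦ ?_).continuous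
    refine (dist_inf_inf_le p.1 p.2 q.1 q.2).trans ?_
    have h1 : dist p.1 q.1 ≤ dist p q := le_max_left _ _
    have h2 : dist p.2 q.2 ≤ dist p q := le_max_right _ _
    norm_num
    linarith

theorem continuous_compl : Continuous (compl : B → B) :=
  (Isometry.of_dist_eq dist_compl).continuous

omit [MeasureAlgebra B] in
@[fun_prop] theorem continuous_ms : Continuous (ms : B → ℝ) := continuous_id.dist continuous_const

instance : OrderClosedTopology B where
  isClosed_le' := by
    have : {p : B × B | p.1 ≤ p.2} = {p : B × B | p.1 ⊓ p.2 = p.1} := by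
      ext p; simp
    rw [this]
    exact isClosed_eq (continuous_fst.inf continuous_snd) continuous_fst

/-- In a measure algebra, monotone sequences are Cauchy. -/
theorem cauchySeq_of_monotone {f : ℕ → B} (hf : Monotone f) : CauchySeq f := by
  have h1 : CauchySeq (fun n ↦ ms (f n)) := by
    refine (tendsto_atTop_ciSup (fun m n h ↦ ms_mono (hf h)) ?_).cauchySeq
    exact ⟨ms ⊤, by rintro _ ⟨n, rfl⟩; exact ms_mono le_top⟩
  have h2 : ∀ m n, dist (f m) (f n) = dist (ms (f m)) (ms (f n)) := by
    intro m n
    rw [Real.dist_eq]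
    rcases le_total m n with h | h
    · rw [dist_of_le (hf h), abs_sub_comm, abs_of_nonneg (sub_nonneg.2 (ms_mono (hf h)))]
    · rw [dist_comm, dist_of_le (hf h), abs_of_nonneg (sub_nonneg.2 (ms_mono (hf h)))]
  rw [Metric.cauchySeq_iff] at h1 ⊢
  simpa only [h2] using h1

/-- A nonempty closed set which is closed under joins has a greatest element. -/
theorem exists_isGreatest [CompleteSpace B] {T : Set B} (hne : T.Nonempty) (hsup : SupClosed T)
    (hT : IsClosed T) : ∃ t, IsGreatest T t := by
  have hbdd : BddAbove (ms '' T) := ⟨ms ⊤, by rintro _ ⟨n, _, rfl⟩; exact ms_mono le_top⟩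
  set s := sSup (ms '' T) with hs
  have h1 : ∀ n : ℕ, ∃ x ∈ T, s - 1 / ((n : ℝ) + 1) < ms x := by
    intro n
    obtain ⟨_, ⟨x, hx, rfl⟩, h⟩ := exists_lt_of_lt_csSup (hne.image ms)
      (show s - 1 / ((n : ℝ) + 1) < sSup (ms '' T) from sub_lt_self _ (by positivity))
    exact ⟨x, hx, h⟩
  choose x hxT hx using h1
  have hy : ∀ n, partialSups x n ∈ T := by
    intro n
    induction n with
    | zero => simpa using hxT 0
    | succ n ih => rw [partialSups_add_one]; exact hsup ih (hxT _)
  obtain ⟨t, ht⟩ := cauchySeq_tendsto_of_complete (cauchySeq_of_monotone (partialSups x).monotone)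
  have htT : t ∈ T := hT.mem_of_tendsto ht (Eventually.of_forall hy)
  have hts : s ≤ ms t := by
    have h2 : Tendsto (fun n : ℕ ↦ s - 1 / ((n : ℝ) + 1)) atTop (𝓝 (s - 0)) :=
      tendsto_const_nhds.sub tendsto_one_div_add_atTop_nhds_zero_nat
    rw [sub_zero] at h2
    exact le_of_tendsto_of_tendsto' h2 ((continuous_ms.tendsto t).comp ht)
      fun n ↦ (hx n).le.trans (ms_mono (le_partialSups x n))
  -- Since `t` has the largest measure in `T`, joining `z` adds no measure, and distance zero means
  -- equality.
  refine ⟨t, htT, fun z hz ↦ ?_⟩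
  have h3 : ms (t ⊔ z) ≤ s := le_csSup hbdd ⟨_, hsup htT hz, rfl⟩
  have h4 : dist t (t ⊔ z) ≤ 0 := by rw [dist_of_le le_sup_left]; linarith
  rw [dist_le_zero.1 h4]
  exact le_sup_right

theorem supClosed_closure {T : Set B} (h : SupClosed T) : SupClosed (closure T) :=
  fun _ hx _ hy ↦ map_mem_closure₂ continuous_sup hx hy fun _ ha _ hb ↦ h ha hb

/-- Nonempty sets closed under joins have a least upper bound, in their closure. -/
theorem exists_isLUB_mem_closure [CompleteSpace B] {T : Set B} (hne : T.Nonempty)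
    (hsup : SupClosed T) : ∃ t ∈ closure T, IsLUB T t := by
  obtain ⟨t, ht, h⟩ := exists_isGreatest hne.closure (supClosed_closure hsup) isClosed_closure
  exact ⟨t, ht, fun x hx ↦ h (subset_closure hx), fun u hu ↦ closure_minimal hu isClosed_Iic ht⟩

theorem exists_isLUB [CompleteSpace B] (S : Set B) : ∃ t, IsLUB S t := by
  rcases S.eq_empty_or_nonempty with rfl | hS
  · exact ⟨⊥, isLUB_empty⟩
  · obtain ⟨t, -, ht⟩ := exists_isLUB_mem_closure (T := supClosure S)
      (hS.mono subset_supClosure) supClosed_supClosure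
    exact ⟨t, by simpa [IsLUB] using ht⟩

/-- A closed set which is closed under joins contains least upper bounds of its nonempty
subsets. -/
theorem isLUB_mem [CompleteSpace B] {S T : Set B} (hS : S.Nonempty) (hST : S ⊆ T)
    (hsup : SupClosed T) (hT : IsClosed T) {t : B} (ht : IsLUB S t) : t ∈ T := by
  obtain ⟨t', h1, h2⟩ := exists_isLUB_mem_closure (T := supClosure S)
      (hS.mono subset_supClosure) supClosed_supClosure
  have h3 : IsLUB S t' := by simpa [IsLUB] using h2
  rw [ht.unique h3]
  exact closure_minimal (supClosure_min hST hsup) hT h1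

omit [MetricSpace B] [MeasureAlgebra B] in
theorem disjoint_of_isLUB {S : Set B} {t b : B} (ht : IsLUB S t) (h : ∀ s ∈ S, Disjoint b s) :
    Disjoint b t := by
  rw [disjoint_comm, ← le_compl_iff_disjoint_right]
  exact ht.2 fun s hs ↦ le_compl_iff_disjoint_right.2 (h s hs).symm

theorem ms_finset_sup {ι : Type*} {a : ι → B} (h : Pairwise (Function.onFun Disjoint a))
    (F : Finset ι) : ms (F.sup a) = ∑ i ∈ F, ms (a i) := by
  classical
  induction F using Finset.induction_on with
  | empty => simp
  | insert i F hi ih =>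
    rw [Finset.sup_insert, Finset.sum_insert hi, ← ih, ms_sup_of_disjoint]
    exact Finset.disjoint_sup_right.2 fun j hj ↦ h fun hij ↦ hi (hij ▸ hj)

/-- The measure is completely additive. -/
theorem hasSum_ms [CompleteSpace B] {ι : Type*} {a : ι → B}
    (h : Pairwise (Function.onFun Disjoint a)) {t : B} (ht : IsLUB (Set.range a) t) :
    HasSum (fun i ↦ ms (a i)) (ms t) := by
  classical
  -- The finite joins form a set closed under joins with the same upper bounds as the family, so
  -- they come arbitrarily close to `t`.
  have h1 : t ∈ closure (Set.range fun F : Finset ι ↦ F.sup a) := by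
    obtain ⟨t', ht', h2⟩ := exists_isLUB_mem_closure (T := Set.range fun F : Finset ι ↦ F.sup a)
      ⟨_, ⟨∅, rfl⟩⟩ (by rintro _ ⟨F, rfl⟩ _ ⟨G, rfl⟩; exact ⟨F ∪ G, Finset.sup_union⟩)
    convert ht'
    refine ht.unique ⟨?_, fun u hu ↦ h2.2 ?_⟩
    · rintro _ ⟨i, rfl⟩
      exact h2.1 ⟨{i}, by simp⟩
    · rintro _ ⟨F, rfl⟩
      exact Finset.sup_le fun i _ ↦ hu ⟨i, rfl⟩
  have hle : ∀ F : Finset ι, F.sup a ≤ t := fun F ↦ Finset.sup_le fun i _ ↦ ht.1 ⟨i, rfl⟩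
  rw [HasSum, Metric.tendsto_nhds]
  intro ε hε
  obtain ⟨_, ⟨F, rfl⟩, hF⟩ := Metric.mem_closure_iff.1 h1 ε hε
  filter_upwards [eventually_ge_atTop F] with G hG
  have h3 : ms (F.sup a) ≤ ms (G.sup a) := ms_mono (Finset.sup_mono hG)
  have h4 := ms_mono (hle G)
  rw [dist_comm, dist_of_le (hle F)] at hF
  rw [← ms_finset_sup h, Real.dist_eq, abs_sub_comm, abs_of_nonneg (by linarith)]
  linarith

end Basic

end MeasureAlgebra

namespace MeasureAlgebra

open Filter Topology BooleanSubalgebra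

variable {B : Type*} [BooleanAlgebra B] [MetricSpace B] [MeasureAlgebra B]

/-! ### Charges on a closed subalgebra and their Hahn decomposition -/

/-- `l` is a finitely additive real functional on `D`, bounded by a multiple of the measure. -/
structure IsChargeOn (D : BooleanSubalgebra B) (K : ℝ) (l : B → ℝ) : Prop where
  add : ∀ x ∈ D, ∀ y ∈ D, Disjoint x y → l (x ⊔ y) = l x + l y
  bound : ∀ x ∈ D, |l x| ≤ K * ms x

namespace IsChargeOn

variable {D : BooleanSubalgebra B} {K : ℝ} {l : B → ℝ}

omit [MeasureAlgebra B] in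
theorem inf_add_sdiff (h : IsChargeOn D K l) {x y : B} (hx : x ∈ D) (hy : y ∈ D) :
    l (x ⊓ y) + l (x \ y) = l x := by
  rw [← h.add _ (inf_mem hx hy) _ (sdiff_mem hx hy) disjoint_inf_sdiff, sup_inf_sdiff]

omit [MeasureAlgebra B] in
theorem sup_add_inf (h : IsChargeOn D K l) {x y : B} (hx : x ∈ D) (hy : y ∈ D) :
    l (x ⊔ y) + l (x ⊓ y) = l x + l y := by
  have h1 := h.inf_add_sdiff hy hx
  have h2 := h.add _ hx _ (sdiff_mem hy hx) disjoint_sdiff_self_right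
  rw [sup_sdiff_self_right] at h2
  rw [inf_comm] at h1
  linarith

theorem abs_sub_le (h : IsChargeOn D K l) {x y : B} (hx : x ∈ D) (hy : y ∈ D) :
    |l x - l y| ≤ K * dist x y := by
  have h1 := h.inf_add_sdiff hx hy
  have h2 := h.inf_add_sdiff hy hx
  rw [inf_comm] at h2
  have h3 : l x - l y = l (x \ y) - l (y \ x) := by linarith
  rw [h3, dist_eq_sdiff, mul_add]
  exact (abs_sub _ _).trans (add_le_add (h.bound _ (sdiff_mem hx hy)) (h.bound _ (sdiff_mem hy hx)))

theorem tendsto (h : IsChargeOn D K l) {f : ℕ → B} {t : B} (hf : ∀ n, f n ∈ D) (htD : t ∈ D)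
    (ht : Tendsto f atTop (𝓝 t)) : Tendsto (fun n ↦ l (f n)) atTop (𝓝 (l t)) := by
  rw [tendsto_iff_dist_tendsto_zero] at ht ⊢
  have h1 := ht.const_mul K
  rw [mul_zero] at h1
  exact squeeze_zero (fun _ ↦ dist_nonneg) (fun n ↦ h.abs_sub_le (hf n) htD) h1

theorem bddAbove (h : IsChargeOn D K l) : BddAbove (l '' D) := by
  refine ⟨|K| * ms (⊤ : B), ?_⟩
  rintro _ ⟨x, hx, rfl⟩
  calc l x ≤ |l x| := le_abs_self _
    _ ≤ K * ms x := h.bound x hx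
    _ ≤ |K| * ms x := mul_le_mul_of_nonneg_right (le_abs_self K) (ms_nonneg x)
    _ ≤ |K| * ms ⊤ := mul_le_mul_of_nonneg_left (ms_mono le_top) (abs_nonneg K)

omit [MeasureAlgebra B] in
-- By modularity and `l (x ⊓ y) ≤ s`, the defects `s - l x` and `s - l y` add up to a bound for the
-- defect of `x ⊔ y`. The geometric sum of the first `n + 1` defects is `ε * (2 - (1 / 2) ^ n)`.
theorem le_partialSups (h : IsChargeOn D K l) {s : ℝ} (hs : ∀ x ∈ D, l x ≤ s) {b : ℕ → B}
    (hb : ∀ n, b n ∈ D) {ε : ℝ} (hbs : ∀ n, s - ε * (1 / 2) ^ n ≤ l (b n)) (n : ℕ) :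
    partialSups b n ∈ D ∧ s - ε * (2 - (1 / 2) ^ n) ≤ l (partialSups b n) := by
  induction n with
  | zero => exact ⟨by simpa using hb 0, by have := hbs 0; simp at this ⊢; linarith⟩
  | succ n ih =>
    rw [partialSups_add_one]
    refine ⟨sup_mem ih.1 (hb _), ?_⟩
    have h1 := h.sup_add_inf ih.1 (hb (n + 1))
    have h2 := hs _ (inf_mem ih.1 (hb (n + 1)))
    have h3 := hbs (n + 1)
    rw [pow_succ] at h3 ⊢
    linarith [ih.2]

variable [CompleteSpace B]

/-- The maximum is attained at the limit superior of a maximizing sequence: with defects `(1 / 2) ^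
n`, the tail joins have defects at most `2 * (1 / 2) ^ m`, and they decrease to a limit at which `l`
is continuous. -/
theorem exists_forall_le (h : IsChargeOn D K l) (hD : IsClosed (D : Set B)) :
    ∃ b ∈ D, ∀ x ∈ D, l x ≤ l b := by
  set s := sSup (l '' D)
  have hs : ∀ x ∈ D, l x ≤ s := fun x hx ↦ le_csSup h.bddAbove ⟨x, hx, rfl⟩
  have h1 : ∀ n : ℕ, ∃ x ∈ D, s - (1 / 2) ^ n ≤ l x := by
    intro n
    obtain ⟨_, ⟨x, hx, rfl⟩, h⟩ := exists_lt_of_lt_csSup (Set.Nonempty.image l ⟨⊥, D.bot_mem'⟩)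
      (show s - (1 / 2) ^ n < sSup (l '' D) from sub_lt_self _ (by positivity))
    exact ⟨x, hx, h.le⟩
  choose b hbD hb using h1
  have h2 : ∀ m : ℕ, ∃ e ∈ D, IsLUB (Set.range fun i ↦ b (m + i)) e ∧
      s - 2 * (1 / 2) ^ m ≤ l e := by
    intro m
    have h3 := h.le_partialSups hs (b := fun i ↦ b (m + i)) (fun i ↦ hbD _) (ε := (1 / 2) ^ m)
      fun n ↦ by rw [← pow_add]; exact hb _
    obtain ⟨e, he⟩ := cauchySeq_tendsto_of_complete
      (cauchySeq_of_monotone (partialSups fun i ↦ b (m + i)).monotone)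
    have heD : e ∈ D := hD.mem_of_tendsto he (Eventually.of_forall fun n ↦ (h3 n).1)
    refine ⟨e, heD, ?_, ?_⟩
    · have := isLUB_of_tendsto_atTop (partialSups fun i ↦ b (m + i)).monotone he
      rwa [IsLUB, upperBounds_range_partialSups] at this
    · refine ge_of_tendsto' (h.tendsto (fun n ↦ (h3 n).1) heD he) fun n ↦ le_trans ?_ (h3 n).2
      have : (0 : ℝ) ≤ (1 / 2) ^ m * (1 / 2) ^ n := by positivity
      linarith
  choose e heD he hel using h2
  have hanti : Antitone e := antitone_nat_of_succ_le fun m ↦ (he (m + 1)).2 <| by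
    rintro _ ⟨i, rfl⟩
    exact (he m).1 ⟨1 + i, by simp [add_assoc]⟩
  -- Convergence of the decreasing sequence is reduced to the increasing case by complements.
  obtain ⟨t, ht⟩ := cauchySeq_tendsto_of_complete
    (cauchySeq_of_monotone (f := fun n ↦ (e n)ᶜ) fun m n hmn ↦ compl_le_compl (hanti hmn))
  have ht' : Tendsto e atTop (𝓝 tᶜ) := by
    simpa [Function.comp_def] using (continuous_compl.tendsto t).comp ht
  have htD : tᶜ ∈ D := hD.mem_of_tendsto ht' (Eventually.of_forall heD)
  refine ⟨tᶜ, htD, fun x hx ↦ (hs x hx).trans ?_⟩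
  have h4 : Tendsto (fun m : ℕ ↦ s - 2 * (1 / 2 : ℝ) ^ m) atTop (𝓝 (s - 2 * 0)) :=
    tendsto_const_nhds.sub ((tendsto_pow_atTop_nhds_zero_of_lt_one (by norm_num)
      (by norm_num)).const_mul 2)
  rw [mul_zero, sub_zero] at h4
  exact le_of_tendsto_of_tendsto' h4 (h.tendsto heD htD ht') hel

/-- **Hahn decomposition** on a closed subalgebra. -/
theorem exists_hahn (h : IsChargeOn D K l) (hD : IsClosed (D : Set B)) :
    ∃ b ∈ D, (∀ x ∈ D, x ≤ b → 0 ≤ l x) ∧ ∀ x ∈ D, x ≤ bᶜ → l x ≤ 0 := by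
  obtain ⟨b, hb, hmax⟩ := h.exists_forall_le hD
  refine ⟨b, hb, fun x hx hxb ↦ ?_, fun x hx hxb ↦ ?_⟩
  · have h1 := h.inf_add_sdiff hb hx
    rw [inf_eq_right.2 hxb] at h1
    linarith [hmax _ (sdiff_mem hb hx)]
  · have h1 := h.add _ hb _ hx (le_compl_iff_disjoint_left.1 hxb)
    linarith [hmax _ (sup_mem hb hx)]

end IsChargeOn

/-! ### Realising functionals over a subalgebra -/

section RelativelyAtomless

variable {D : BooleanSubalgebra B}

theorem ms_inf_sup_of_disjoint (a : B) {x y : B} (h : Disjoint x y) :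
    ms (a ⊓ (x ⊔ y)) = ms (a ⊓ x) + ms (a ⊓ y) := by
  rw [inf_sup_left, ms_sup_of_disjoint (h.mono inf_le_right inf_le_right)]

theorem ms_inf_sup_inf_compl (x y z : B) :
    ms (x ⊓ z ⊔ y ⊓ zᶜ) = ms (z ⊓ x) + (ms y - ms (z ⊓ y)) := by
  rw [ms_sup_of_disjoint (disjoint_compl_right.mono inf_le_right inf_le_right), inf_comm x,
    ← sdiff_eq, inf_comm z y, ← ms_inf_add_sdiff y z]
  ring

/-- The algebra is relatively atomless over `D`: no nonzero principal ideal is the trace of `D`. -/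
def RelativelyAtomless (D : BooleanSubalgebra B) : Prop :=
  ∀ a : B, a ≠ ⊥ → ∃ e ≤ a, ∀ d ∈ D, e ≠ a ⊓ d

variable [CompleteSpace B]

/-- Take `e ≤ a` that is not a trace of `D`. A Hahn decomposition splits the algebra along some `b₀
∈ D` into a part where `e` is at most half of `a` and a part where `a \ e` is; `d` takes the smaller
one on each side. If both pieces vanished, `e` would be the trace of `b₀ᶜ`. -/
theorem RelativelyAtomless.exists_half (h : RelativelyAtomless D) (hD : IsClosed (D : Set B))
    {a : B} (ha : a ≠ ⊥) : ∃ d ≤ a, d ≠ ⊥ ∧ ∀ b ∈ D, 2 * ms (d ⊓ b) ≤ ms (a ⊓ b) := by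
  obtain ⟨e, hea, he⟩ := h a ha
  have hc : IsChargeOn D 3 fun x ↦ ms (a ⊓ x) - 2 * ms (e ⊓ x) := by
    refine ⟨fun x _ y _ hxy ↦ ?_, fun x _ ↦ ?_⟩
    · simp only [ms_inf_sup_of_disjoint _ hxy]
      ring
    · have h1 := ms_mono (inf_le_right : a ⊓ x ≤ x)
      have h2 := ms_mono (inf_le_right : e ⊓ x ≤ x)
      rw [abs_le]
      constructor <;> linarith [ms_nonneg (a ⊓ x), ms_nonneg (e ⊓ x)]
  obtain ⟨b₀, hb₀, hpos, hneg⟩ := hc.exists_hahn hD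
  have hle : e ⊓ b₀ ⊔ (a \ e) \ b₀ ≤ a :=
    sup_le (inf_le_left.trans hea) (sdiff_le.trans sdiff_le)
  refine ⟨e ⊓ b₀ ⊔ (a \ e) \ b₀, hle, fun hbot ↦ ?_, fun b hb ↦ ?_⟩
  · obtain ⟨h1, h2⟩ := sup_eq_bot_iff.1 hbot
    refine he b₀ᶜ (compl_mem hb₀) (le_antisymm ?_ ?_)
    · exact le_inf hea (le_compl_iff_disjoint_right.2 (disjoint_iff.2 h1))
    · rw [← sdiff_eq]
      rw [sdiff_sdiff_comm, sdiff_eq_bot_iff] at h2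
      exact h2
  · have h1 := hpos (b ⊓ b₀) (inf_mem hb hb₀) inf_le_right
    have h2 := hneg (b \ b₀) (sdiff_mem hb hb₀) (by rw [sdiff_eq]; exact inf_le_right)
    have h3 : ms ((e ⊓ b₀ ⊔ (a \ e) \ b₀) ⊓ b) ≤ ms (e ⊓ (b ⊓ b₀)) + ms ((a \ e) ⊓ (b \ b₀)) := by
      rw [inf_sup_right]
      refine (ms_sup_le _ _).trans (le_of_eq ?_)
      congr 2
      · rw [inf_assoc, inf_comm b]
      · simp only [sdiff_eq, inf_assoc, inf_comm b]
    have h4 : ms (a ⊓ b) = ms (a ⊓ (b ⊓ b₀)) + ms (a ⊓ (b \ b₀)) := by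
      rw [← ms_inf_sup_of_disjoint _ disjoint_inf_sdiff, sup_inf_sdiff]
    have h5 : ms ((a \ e) ⊓ (b \ b₀)) = ms (a ⊓ (b \ b₀)) - ms (e ⊓ (b \ b₀)) := by
      rw [← ms_sdiff (inf_le_inf_right _ hea), inf_sdiff_distrib_right]
    linarith

theorem RelativelyAtomless.exists_small (h : RelativelyAtomless D) (hD : IsClosed (D : Set B))
    {a : B} (ha : a ≠ ⊥) (n : ℕ) :
    ∃ d ≤ a, d ≠ ⊥ ∧ ∀ b ∈ D, 2 ^ n * ms (d ⊓ b) ≤ ms (a ⊓ b) := by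
  induction n with
  | zero => exact ⟨a, le_rfl, ha, fun b _ ↦ by simp⟩
  | succ n ih =>
    obtain ⟨d, hda, hd, h1⟩ := ih
    obtain ⟨d', hdd, hd', h2⟩ := h.exists_half hD hd
    refine ⟨d', hdd.trans hda, hd', fun b hb ↦ ?_⟩
    rw [pow_succ, mul_assoc]
    exact (mul_le_mul_of_nonneg_left (h2 b hb) (by positivity)).trans (h1 b hb)

/-- If the algebra is relatively atomless over the closed subalgebra `D`, every additive functional
on `D` between `0` and the measure is of the form `d ↦ ms (c ⊓ d)`. -/
theorem RelativelyAtomless.exists_ms_inf_eq (h : RelativelyAtomless D) (hD : IsClosed (D : Set B))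
    {ν : B → ℝ} (hadd : ∀ x ∈ D, ∀ y ∈ D, Disjoint x y → ν (x ⊔ y) = ν x + ν y)
    (h0 : ∀ x ∈ D, 0 ≤ ν x) (hle : ∀ x ∈ D, ν x ≤ ms x) :
    ∃ c : B, ∀ d ∈ D, ms (c ⊓ d) = ν d := by
  let T : Set B := {c | ∀ d ∈ D, ms (c ⊓ d) ≤ ν d}
  have hT : IsClosed T := by
    have : T = ⋂ d ∈ D, {c | ms (c ⊓ d) ≤ ν d} := by ext; simp [T]
    rw [this]
    exact isClosed_biInter fun d _ ↦ isClosed_le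
      (continuous_ms.comp (continuous_id.inf continuous_const)) continuous_const
  obtain ⟨c, hc⟩ := zorn_le_nonempty₀ T (fun C hCT hC y hy ↦ by
    obtain ⟨t, ht, hlub⟩ := exists_isLUB_mem_closure ⟨y, hy⟩
      (T := C) fun x hx y hy ↦ by
        rcases hC.total hx hy with h | h
        · rwa [sup_eq_right.2 h]
        · rwa [sup_eq_left.2 h]
    exact ⟨t, closure_minimal hCT hT ht, hlub.1⟩) ⊥ (fun d hd ↦ by simpa using h0 d hd)
  have hcT : ∀ d ∈ D, ms (c ⊓ d) ≤ ν d := hc.2.prop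
  refine ⟨c, ?_⟩
  by_contra! hne
  obtain ⟨d₀, hd₀, hd₀'⟩ := hne
  have hlt₀ : 0 < ν d₀ - ms (c ⊓ d₀) := sub_pos.2 ((hcT _ hd₀).lt_of_ne hd₀')
  -- The defect `ν - ms (c ⊓ ·)` is additive and nonnegative on `D`, so it is positive at `⊤` as
  -- soon as it is positive somewhere.
  have hlt : 0 < ν ⊤ - ms (c ⊓ ⊤) := by
    have h1 := hadd _ hd₀ _ (compl_mem hd₀) disjoint_compl_right
    have h2 := ms_inf_sup_of_disjoint c (disjoint_compl_right (a := d₀))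
    rw [sup_compl_eq_top] at h1 h2
    linarith [hcT _ (compl_mem hd₀)]
  obtain ⟨n, hn⟩ := exists_nat_gt (ms (⊤ : B) / (ν ⊤ - ms (c ⊓ ⊤)))
  set δ : ℝ := (1 / 2) ^ n with hδ
  have hδ0 : 0 < δ := by positivity
  have hδ1 : δ * 2 ^ n = 1 := by rw [hδ, ← mul_pow]; norm_num
  have hn' : δ * ms (⊤ : B) < ν ⊤ - ms (c ⊓ ⊤) := by
    have h1 : ms (⊤ : B) < 2 ^ n * (ν ⊤ - ms (c ⊓ ⊤)) := by
      rw [div_lt_iff₀ hlt] at hn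
      refine hn.trans (mul_lt_mul_of_pos_right ?_ hlt)
      exact_mod_cast n.lt_two_pow_self
    calc δ * ms (⊤ : B) < δ * (2 ^ n * (ν ⊤ - ms (c ⊓ ⊤))) := mul_lt_mul_of_pos_left h1 hδ0
      _ = _ := by rw [← mul_assoc, hδ1, one_mul]
  have hcharge : IsChargeOn D (2 + δ) fun x ↦ ν x - ms (c ⊓ x) - δ * ms x := by
    refine ⟨fun x hx y hy hxy ↦ ?_, fun x hx ↦ ?_⟩
    · simp only [ms_inf_sup_of_disjoint _ hxy, hadd x hx y hy hxy, ms_sup_of_disjoint hxy]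
      ring
    · have h2 := ms_mono (inf_le_right : c ⊓ x ≤ x)
      have h3 := ms_nonneg (c ⊓ x)
      have h4 := h0 x hx
      have h5 := hle x hx
      have h6 : 0 ≤ δ * ms x := mul_nonneg hδ0.le (ms_nonneg x)
      rw [abs_le]
      constructor <;> linarith [ms_nonneg x]
  -- Below `b₀` the defect is at least `δ` times the measure, which leaves room to enlarge `c`
  -- there.
  obtain ⟨b₀, hb₀, hpos, hneg⟩ := hcharge.exists_hahn hD
  -- If `b₀ ≤ c`, then `ν ≤ ms` makes the charge nonpositive at `b₀`, hence at `⊤`, contrary to the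
  -- choice of `δ`.
  have ha : b₀ \ c ≠ ⊥ := by
    intro hbot
    have hbc : b₀ ≤ c := sdiff_eq_bot_iff.1 hbot
    have h1 := hpos b₀ hb₀ le_rfl
    have h2 := hneg b₀ᶜ (compl_mem hb₀) le_rfl
    have h3 := hcharge.add _ hb₀ _ (compl_mem hb₀) disjoint_compl_right
    simp only [sup_compl_eq_top] at h3
    have h4 := hle b₀ hb₀
    simp only [inf_eq_right.2 hbc] at h1 h3
    have h5 : 0 ≤ δ * ms b₀ := mul_nonneg hδ0.le (ms_nonneg _)
    linarith
  obtain ⟨d, hdle, hd, hsmall⟩ := h.exists_small hD ha n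
  -- The added piece `d` costs at most `δ * ms (b ⊓ b₀)`, which the defect on `b ⊓ b₀` covers.
  have hcd : c ⊔ d ∈ T := by
    intro b hb
    have hdisj : Disjoint c d := (disjoint_sdiff_self_right).mono_right hdle
    rw [inf_sup_right, ms_sup_of_disjoint (hdisj.mono inf_le_left inf_le_left)]
    have h1 := hpos (b ⊓ b₀) (inf_mem hb hb₀) inf_le_right
    have h2 := hcT (b \ b₀) (sdiff_mem hb hb₀)
    have h3 := hadd _ (inf_mem hb hb₀) _ (sdiff_mem hb hb₀) disjoint_inf_sdiff
    rw [sup_inf_sdiff] at h3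
    have h4 := ms_inf_sup_of_disjoint c (disjoint_inf_sdiff (x := b) (y := b₀))
    rw [sup_inf_sdiff] at h4
    have h5 : ms (d ⊓ b) ≤ δ * ms (b ⊓ b₀) := by
      calc ms (d ⊓ b) = δ * (2 ^ n * ms (d ⊓ b)) := by rw [← mul_assoc, hδ1, one_mul]
        _ ≤ δ * ms ((b₀ \ c) ⊓ b) := mul_le_mul_of_nonneg_left (hsmall b hb) hδ0.le
        _ ≤ δ * ms (b ⊓ b₀) := mul_le_mul_of_nonneg_left
          (ms_mono (le_inf inf_le_right (inf_le_left.trans sdiff_le))) hδ0.le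
    linarith
  have hdc : d ≤ c := le_sup_right.trans (hc.2.le_of_ge hcd le_sup_left)
  exact hd (le_bot_iff.1 ((disjoint_sdiff_self_right (x := c)) hdc hdle))

end RelativelyAtomless

end MeasureAlgebra

namespace BooleanSubalgebra

/-! ### Generated subalgebras and their cardinality -/

section Closure

variable {E : Type*} [BooleanAlgebra E]

theorem exists_of_mem_closure_insert {R : Set E} {q x : E} (hx : x ∈ closure (insert q R)) :
    ∃ a ∈ closure R, ∃ b ∈ closure R, x = a ⊓ q ⊔ b ⊓ qᶜ := by
  induction hx using closure_bot_sup_induction with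
  | mem x hx =>
    rcases hx with rfl | hx
    · exact ⟨⊤, top_mem, ⊥, bot_mem, by simp⟩
    · exact ⟨x, subset_closure hx, x, subset_closure hx, by rw [← inf_sup_left]; simp⟩
  | bot => exact ⟨⊥, bot_mem, ⊥, bot_mem, by simp⟩
  | sup x _ y _ ihx ihy =>
    obtain ⟨a, ha, b, hb, rfl⟩ := ihx
    obtain ⟨a', ha', b', hb', rfl⟩ := ihy
    refine ⟨a ⊔ a', sup_mem ha ha', b ⊔ b', sup_mem hb hb', ?_⟩
    rw [inf_sup_right, inf_sup_right, sup_sup_sup_comm]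
  | compl x _ ih =>
    obtain ⟨a, ha, b, hb, rfl⟩ := ih
    refine ⟨aᶜ, compl_mem ha, bᶜ, compl_mem hb, ?_⟩
    refine (IsCompl.of_eq ?_ ?_).compl_eq
    · simp only [inf_sup_left, inf_sup_right]
      have h1 : a ⊓ q ⊓ (aᶜ ⊓ q) = ⊥ := by rw [inf_inf_inf_comm]; simp
      have h2 : a ⊓ q ⊓ (bᶜ ⊓ qᶜ) = ⊥ := by rw [inf_inf_inf_comm]; simp
      have h3 : b ⊓ qᶜ ⊓ (aᶜ ⊓ q) = ⊥ := by rw [inf_inf_inf_comm]; simp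
      have h4 : b ⊓ qᶜ ⊓ (bᶜ ⊓ qᶜ) = ⊥ := by rw [inf_inf_inf_comm]; simp
      simp [h1, h2, h3, h4]
    · rw [sup_sup_sup_comm, ← inf_sup_right, ← inf_sup_right]
      simp

theorem finite_closure {R : Set E} (hR : R.Finite) : (closure R : Set E).Finite := by
  induction R, hR using Set.Finite.induction_on with
  | empty =>
    refine (Set.toFinite ({⊥, ⊤} : Set E)).subset fun x hx ↦ ?_
    exact (closure_le (L := ⊥)).2 (Set.empty_subset _) hx
  | @insert q _ _ _ ih =>
    refine (Set.Finite.image2 (fun a b ↦ a ⊓ q ⊔ b ⊓ qᶜ) ih ih).subset fun x hx ↦ ?_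
    obtain ⟨a, ha, b, hb, rfl⟩ := exists_of_mem_closure_insert hx
    exact ⟨a, ha, b, hb, rfl⟩

theorem exists_finset_of_mem_closure {R : Set E} {x : E} (hx : x ∈ closure R) :
    ∃ F : Finset E, (F : Set E) ⊆ R ∧ x ∈ closure (F : Set E) := by
  classical
  induction hx using closure_bot_sup_induction with
  | mem x hx => exact ⟨{x}, by simpa using hx, subset_closure (by simp)⟩
  | bot => exact ⟨∅, by simp, bot_mem⟩
  | sup x _ y _ ihx ihy =>
    obtain ⟨F, hF, hxF⟩ := ihx
    obtain ⟨G, hG, hyG⟩ := ihy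
    refine ⟨F ∪ G, by simp [hF, hG], sup_mem (closure_mono ?_ hxF) (closure_mono ?_ hyG)⟩
    · simp
    · simp
  | compl x _ ih =>
    obtain ⟨F, hF, hxF⟩ := ih
    exact ⟨F, hF, compl_mem hxF⟩

end Closure

/-- An infinite `R` generates the union of the finite subalgebras generated by its finite subsets,
of which there are `#R`; a finite `R` generates a finite subalgebra. -/
theorem mk_closure_lt {E : Type u} [BooleanAlgebra E] {R : Set E} {κ : Cardinal.{u}} (hκ : ℵ₀ ≤ κ)
    (hR : #R < κ) : #(closure R : Set E) < κ := by
  rcases lt_or_ge #R ℵ₀ with h | h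
  · exact (Cardinal.lt_aleph0_iff_set_finite.2
      (finite_closure (Cardinal.lt_aleph0_iff_set_finite.1 h))).trans_le hκ
  · have : Infinite R := Cardinal.infinite_iff.2 h
    refine lt_of_le_of_lt ?_ hR
    have h1 : (closure R : Set E) ⊆ ⋃ F : Finset R, (closure ((↑) '' (F : Set R) : Set E) : Set E) := by
      intro x hx
      obtain ⟨F, hF, hxF⟩ := exists_finset_of_mem_closure hx
      classical
      refine Set.mem_iUnion.2 ⟨F.subtype (· ∈ R), ?_⟩
      have h2 : (↑) '' (F.subtype (· ∈ R) : Set R) = (F : Set E) := by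
        ext y
        simpa using fun hy ↦ hF hy
      rwa [h2]
    refine (Cardinal.mk_le_mk_of_subset h1).trans ((Cardinal.mk_iUnion_le _).trans ?_)
    rw [Cardinal.mk_finset_of_infinite]
    refine (mul_le_mul_right (ciSup_le' fun F ↦ ?_) _).trans (Cardinal.mul_aleph0_eq h).le
    exact (Cardinal.lt_aleph0_iff_set_finite.2 (finite_closure (F.finite_toSet.image _))).le

section Topology

variable {E : Type*} [BooleanAlgebra E] [TopologicalSpace E] [ContinuousSup E] [ContinuousInf E]

/-- The topological closure of a Boolean subalgebra. -/
def topologicalClosure (S : BooleanSubalgebra E) (hc : Continuous (compl : E → E)) :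
    BooleanSubalgebra E where
  carrier := _root_.closure S
  supClosed' _ hx _ hy := map_mem_closure₂ continuous_sup hx hy fun _ ha _ hb ↦ S.supClosed ha hb
  infClosed' _ hx _ hy := map_mem_closure₂ continuous_inf hx hy fun _ ha _ hb ↦ S.infClosed ha hb
  compl_mem' hx := map_mem_closure hc hx fun _ ha ↦ compl_mem ha
  bot_mem' := _root_.subset_closure bot_mem

end Topology

end BooleanSubalgebra

namespace MeasureAlgebra

open Filter Topology

theorem density_le {X : Type u} [TopologicalSpace X] {s : Set X} (hs : Dense s) :
    density X ≤ #s := csInf_le' ⟨s, hs, rfl⟩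

theorem exists_dense (X : Type u) [TopologicalSpace X] : ∃ s : Set X, Dense s ∧ #s = density X :=
  csInf_mem (s := {κ | ∃ s : Set X, Dense s ∧ #s = κ}) ⟨_, Set.univ, dense_univ, rfl⟩

/-! ### Matchings: graphs of partial isomorphisms -/

section Matching

variable {A C : Type*} [BooleanAlgebra A] [MetricSpace A] [MeasureAlgebra A]
  [BooleanAlgebra C] [MetricSpace C] [MeasureAlgebra C]

/-- A subalgebra of the product is a matching if the two coordinates have the same measure; it is
then the graph of a measure-preserving partial isomorphism. -/
def IsMatching (S : BooleanSubalgebra (A × C)) : Prop := ∀ p ∈ S, ms p.1 = ms p.2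

/-- The image of a subalgebra under exchange of the two factors. -/
def swap (S : BooleanSubalgebra (A × C)) : BooleanSubalgebra (C × A) where
  carrier := Prod.swap ⁻¹' S
  supClosed' _ hx _ hy := S.supClosed hx hy
  infClosed' _ hx _ hy := S.infClosed hx hy
  compl_mem' hx := BooleanSubalgebra.compl_mem hx
  bot_mem' := S.bot_mem'

/-- The second projection of a subalgebra. -/
def sndImage (S : BooleanSubalgebra (A × C)) : BooleanSubalgebra C where
  carrier := {c | ∃ a, (a, c) ∈ S}
  supClosed' := fun _ ⟨a, ha⟩ _ ⟨b, hb⟩ ↦ ⟨a ⊔ b, S.supClosed ha hb⟩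
  infClosed' := fun _ ⟨a, ha⟩ _ ⟨b, hb⟩ ↦ ⟨a ⊓ b, S.infClosed ha hb⟩
  compl_mem' := fun ⟨a, ha⟩ ↦ ⟨aᶜ, BooleanSubalgebra.compl_mem ha⟩
  bot_mem' := ⟨⊥, S.bot_mem'⟩

variable {S : BooleanSubalgebra (A × C)}

omit [MetricSpace A] [MeasureAlgebra A] [MetricSpace C] [MeasureAlgebra C] in
theorem mem_swap {a : A} {c : C} : (c, a) ∈ swap S ↔ (a, c) ∈ S := Iff.rfl

omit [MetricSpace A] [MeasureAlgebra A] [MetricSpace C] [MeasureAlgebra C] in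
theorem mem_sndImage {c : C} : c ∈ sndImage S ↔ ∃ a, (a, c) ∈ S := Iff.rfl

omit [MeasureAlgebra A] [MeasureAlgebra C] in
theorem IsMatching.swap (h : IsMatching S) : IsMatching (swap S) := fun p hp ↦ (h p.swap hp).symm

instance : ContinuousSup (A × C) where
  continuous_sup := by
    refine Continuous.prodMk (f := fun p : (A × C) × (A × C) ↦ p.1.1 ⊔ p.2.1)
      (g := fun p : (A × C) × (A × C) ↦ p.1.2 ⊔ p.2.2) ?_ ?_ <;> fun_prop

instance : ContinuousInf (A × C) where
  continuous_inf := by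
    refine Continuous.prodMk (f := fun p : (A × C) × (A × C) ↦ p.1.1 ⊓ p.2.1)
      (g := fun p : (A × C) × (A × C) ↦ p.1.2 ⊓ p.2.2) ?_ ?_ <;> fun_prop

theorem continuous_compl_prod : Continuous (compl : A × C → A × C) :=
  (continuous_compl.comp continuous_fst).prodMk (continuous_compl.comp continuous_snd)

theorem IsMatching.topologicalClosure (h : IsMatching S) :
    IsMatching (S.topologicalClosure continuous_compl_prod) :=
  closure_minimal (t := {p : A × C | ms p.1 = ms p.2}) h
    (isClosed_eq (continuous_ms.comp continuous_fst) (continuous_ms.comp continuous_snd))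

theorem IsMatching.dist_eq (h : IsMatching S) {p q : A × C} (hp : p ∈ S) (hq : q ∈ S) :
    dist p.2 q.2 = dist p.1 q.1 := by
  rw [dist_eq_sub, dist_eq_sub]
  exact congrArg₂ (· - ·) (h (p ⊔ q) (S.supClosed hp hq)).symm
    (h (p ⊓ q) (S.infClosed hp hq)).symm

theorem IsMatching.fst_eq (h : IsMatching S) {a a' : A} {c : C} (hp : (a, c) ∈ S)
    (hq : (a', c) ∈ S) : a = a' :=
  dist_eq_zero.1 <| (h.dist_eq hp hq).symm.trans (dist_self c)

theorem IsMatching.snd_eq (h : IsMatching S) {a : A} {c c' : C} (hp : (a, c) ∈ S)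
    (hq : (a, c') ∈ S) : c = c' :=
  h.swap.fst_eq hp hq

/-- A matching is isometric, so partners of a convergent sequence form a Cauchy sequence; its limit
is a partner because `S` is closed. -/
theorem IsMatching.isClosed_sndImage [CompleteSpace A] (h : IsMatching S)
    (hS : IsClosed (S : Set (A × C))) : IsClosed (sndImage S : Set C) := by
  refine isClosed_of_closure_subset fun c hc ↦ ?_
  obtain ⟨f, hf, hfc⟩ := mem_closure_iff_seq_limit.1 hc
  choose g hg using fun n ↦ mem_sndImage.1 (hf n)
  have hcau : CauchySeq g := by
    have := hfc.cauchySeq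
    rw [Metric.cauchySeq_iff] at this ⊢
    intro ε hε
    obtain ⟨N, hN⟩ := this ε hε
    refine ⟨N, fun m hm n hn ↦ ?_⟩
    have := h.dist_eq (hg m) (hg n)
    exact this ▸ hN m hm n hn
  obtain ⟨a, ha⟩ := cauchySeq_tendsto_of_complete hcau
  exact mem_sndImage.2 ⟨a, hS.mem_of_tendsto (ha.prodMk_nhds hfc) (Eventually.of_forall hg)⟩

/-- Elements of the enlarged subalgebra have the form `p ⊓ q ⊔ p' ⊓ qᶜ` with `q = (a, c)`, and their
measures are determined by those of `p'`, `q ⊓ p` and `q ⊓ p'`. -/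
theorem IsMatching.closure_insert {R : Set (A × C)} (h : IsMatching (BooleanSubalgebra.closure R))
    {a : A} {c : C} (hac : ∀ p ∈ BooleanSubalgebra.closure R, ms (a ⊓ p.1) = ms (c ⊓ p.2)) :
    IsMatching (BooleanSubalgebra.closure (insert (a, c) R)) := by
  intro x hx
  obtain ⟨p, hp, q, hq, rfl⟩ := BooleanSubalgebra.exists_of_mem_closure_insert hx
  change ms (p.1 ⊓ a ⊔ q.1 ⊓ aᶜ) = ms (p.2 ⊓ c ⊔ q.2 ⊓ cᶜ)
  rw [ms_inf_sup_inf_compl, ms_inf_sup_inf_compl, hac p hp, hac q hq, h q hq]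

omit [MeasureAlgebra A] [MeasureAlgebra C] in
theorem isMatching_closure_empty (htop : ms (⊤ : A) = ms (⊤ : C)) :
    IsMatching (BooleanSubalgebra.closure (∅ : Set (A × C))) := by
  intro x hx
  have h : x ∈ (⊥ : BooleanSubalgebra (A × C)) :=
    BooleanSubalgebra.closure_le.2 (Set.empty_subset _) hx
  rcases BooleanSubalgebra.mem_bot.1 h with rfl | rfl
  · exact ms_bot.trans ms_bot.symm
  · exact htop

theorem IsMatching.exists_orderIso (h : IsMatching S) (h1 : ∀ a, ∃ c, (a, c) ∈ S)
    (h2 : ∀ c, ∃ a, (a, c) ∈ S) : ∃ e : A ≃o C, ∀ a, ms (e a) = ms a := by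
  choose f hf using h1
  choose g hg using h2
  refine ⟨⟨⟨f, g, fun a ↦ h.fst_eq (hg (f a)) (hf a), fun c ↦ h.snd_eq (hf (g c)) (hg c)⟩,
    fun {a b} ↦ ?_⟩, fun a ↦ (h _ (hf a)).symm⟩
  have h3 : (a ⊓ b, f a ⊓ f b) ∈ S := S.infClosed (hf a) (hf b)
  change f a ≤ f b ↔ a ≤ b
  rw [← inf_eq_left, ← inf_eq_left]
  constructor <;> intro h4 <;> rw [h4] at h3
  · exact h.fst_eq h3 (hf a)
  · exact h.snd_eq h3 (hf a)

end Matching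

/-! ### Back-and-forth for homogeneous algebras -/

section Maharam

variable {A C : Type u} [BooleanAlgebra A] [MetricSpace A] [MeasureAlgebra A] [CompleteSpace A]
  [BooleanAlgebra C] [MetricSpace C] [MeasureAlgebra C] [CompleteSpace C] {κ : Cardinal.{u}}

omit [CompleteSpace A] [CompleteSpace C] in
-- If every element below `c` were a trace of the closed range, the traces of the fewer than `κ`
-- elements of `S` would be dense in the ideal of `c`.
theorem relativelyAtomless_sndImage {S : BooleanSubalgebra (A × C)} (hS : #S < κ)
    (hC : ∀ c : C, c ≠ ⊥ → κ ≤ density (Set.Iic c)) :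
    RelativelyAtomless (sndImage (S.topologicalClosure continuous_compl_prod)) := by
  intro c hc
  by_contra! hcon
  refine (hC c hc).not_gt (lt_of_le_of_lt ?_ hS)
  let f : A × C → Set.Iic c := fun p ↦ ⟨c ⊓ p.2, inf_le_left⟩
  have hf : Continuous f := (continuous_const.inf continuous_snd).subtype_mk _
  refine (density_le (s := f '' S) fun x ↦ ?_).trans Cardinal.mk_image_le
  obtain ⟨d, ⟨b, hp⟩, hx⟩ := hcon x.1 x.2
  have : x = f (b, d) := Subtype.ext hx
  rw [this]
  exact map_mem_closure hf hp fun y hy ↦ ⟨y, hy, rfl⟩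

/-- One-point extension of matchings. -/
theorem IsMatching.exists_extension {S : BooleanSubalgebra (A × C)} (h : IsMatching S)
    (hS : #S < κ) (hC : ∀ c : C, c ≠ ⊥ → κ ≤ density (Set.Iic c)) (a : A) :
    ∃ c : C, ∀ p ∈ S, ms (a ⊓ p.1) = ms (c ⊓ p.2) := by
  set T := S.topologicalClosure continuous_compl_prod
  have hTm : IsMatching T := h.topologicalClosure
  -- `g` is the inverse of the closed partial isomorphism; the functional to be realised is `d ↦ ms
  -- (a ⊓ g d)`.
  choose! g hg using fun (d : C) (hd : d ∈ sndImage T) ↦ mem_sndImage.1 hd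
  have hadd : ∀ x ∈ sndImage T, ∀ y ∈ sndImage T, Disjoint x y →
      ms (a ⊓ g (x ⊔ y)) = ms (a ⊓ g x) + ms (a ⊓ g y) := by
    intro x hx y hy hxy
    have h1 : g (x ⊔ y) = g x ⊔ g y :=
      hTm.fst_eq (hg _ (BooleanSubalgebra.sup_mem hx hy)) (T.supClosed (hg x hx) (hg y hy))
    have h2 : (g x ⊓ g y, x ⊓ y) ∈ T := T.infClosed (hg x hx) (hg y hy)
    have h3 : Disjoint (g x) (g y) := by
      rw [disjoint_iff, ← ms_eq_zero, hTm _ h2, ms_eq_zero]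
      exact hxy.eq_bot
    rw [h1, ms_inf_sup_of_disjoint a h3]
  obtain ⟨c, hc⟩ := (relativelyAtomless_sndImage hS hC).exists_ms_inf_eq
    (hTm.isClosed_sndImage isClosed_closure) hadd (fun x _ ↦ ms_nonneg _)
    (fun x hx ↦ (ms_mono inf_le_right).trans (hTm _ (hg x hx)).le)
  refine ⟨c, fun p hp ↦ ?_⟩
  have hpT : p ∈ T := subset_closure hp
  have hp2 : p.2 ∈ sndImage T := ⟨p.1, hpT⟩
  rw [hc _ hp2, hTm.fst_eq (hg _ hp2) hpT]

theorem exists_insert (hκ : ℵ₀ ≤ κ) (hA : ∀ a : A, a ≠ ⊥ → κ ≤ density (Set.Iic a))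
    (hC : ∀ c : C, c ≠ ⊥ → κ ≤ density (Set.Iic c)) {R : Set (A × C)} (hR : #R < κ)
    (h : IsMatching (BooleanSubalgebra.closure R)) (t : A ⊕ C) :
    ∃ q : A × C, (∀ a, t = .inl a → q.1 = a) ∧ (∀ c, t = .inr c → q.2 = c) ∧
      IsMatching (BooleanSubalgebra.closure (insert q R)) := by
  have hcard := BooleanSubalgebra.mk_closure_lt hκ hR
  rcases t with a | c
  · obtain ⟨c, hc⟩ := h.exists_extension hcard hC a
    exact ⟨(a, c), by simp, by simp, h.closure_insert hc⟩
  · have hcard' : #(swap (BooleanSubalgebra.closure R)) < κ :=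
      (Cardinal.mk_le_of_injective
        (f := fun p : swap (BooleanSubalgebra.closure R) ↦
          (⟨p.1.swap, p.2⟩ : (BooleanSubalgebra.closure R : Set (A × C))))
        fun p q hpq ↦ Subtype.ext (Prod.swap_injective (Subtype.ext_iff.1 hpq))).trans_lt hcard
    obtain ⟨a, ha⟩ := h.swap.exists_extension hcard' hA c
    exact ⟨(a, c), by simp, by simp, h.closure_insert fun p hp ↦ (ha p.swap hp).symm⟩

theorem exists_matching_family (hκ : ℵ₀ ≤ κ) (hA : ∀ a : A, a ≠ ⊥ → κ ≤ density (Set.Iic a))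
    (hC : ∀ c : C, c ≠ ⊥ → κ ≤ density (Set.Iic c)) (htop : ms (⊤ : A) = ms (⊤ : C))
    (t : κ.ord.ToType → A ⊕ C) :
    ∃ p : κ.ord.ToType → A × C, (∀ i a, t i = .inl a → (p i).1 = a) ∧
      (∀ i c, t i = .inr c → (p i).2 = c) ∧
      IsMatching (BooleanSubalgebra.closure (Set.range p)) := by
  classical
  let P : Set (A × C) → A ⊕ C → A × C → Prop := fun R t q ↦
    (∀ a, t = .inl a → q.1 = a) ∧ (∀ c, t = .inr c → q.2 = c) ∧
      IsMatching (BooleanSubalgebra.closure (insert q R))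
  -- The default `⊥` lets the recursion be defined before the extension is known to exist; `hstep`
  -- and `hIio` show that it is never used.
  let next : Set (A × C) → A ⊕ C → A × C := fun R t ↦ if h : ∃ q, P R t q then h.choose else ⊥
  let wf : WellFounded (α := κ.ord.ToType) (· < ·) := wellFounded_lt
  let p : κ.ord.ToType → A × C := wf.fix fun i ih ↦ next (Set.range fun j : Set.Iio i ↦ ih j.1 j.2) (t i)
  have hp : ∀ i, p i = next (p '' Set.Iio i) (t i) := by
    intro i
    rw [Set.image_eq_range]
    exact wf.fix_eq _ i
  -- matchings are stable under directed unions
  have hdir : ∀ I : Set κ.ord.ToType,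
      (∀ i ∈ I, IsMatching (BooleanSubalgebra.closure (p '' Set.Iic i))) →
      IsMatching (BooleanSubalgebra.closure (p '' I)) := by
    intro I hI x hx
    obtain ⟨F, hF, hxF⟩ := BooleanSubalgebra.exists_finset_of_mem_closure hx
    obtain ⟨G, hGI, rfl⟩ := Finset.subset_set_image_iff.1 hF
    -- A finite set of generators lies in the initial segment of its largest index. Without
    -- generators only `⊥` and `⊤` remain, and the total masses agree.
    rcases G.eq_empty_or_nonempty with rfl | hG
    · exact isMatching_closure_empty htop x (by simpa using hxF)
    · refine hI _ (hGI (G.max'_mem hG)) x (BooleanSubalgebra.closure_mono ?_ hxF)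
      rw [Finset.coe_image]
      exact Set.image_mono fun j hj ↦ G.le_max' j hj
  have hstep : ∀ i, IsMatching (BooleanSubalgebra.closure (p '' Set.Iio i)) →
      P (p '' Set.Iio i) (t i) (p i) := by
    intro i hi
    have hcard : #(p '' Set.Iio i) < κ :=
      by
      refine Cardinal.mk_image_le.trans_lt ?_
      simpa using Cardinal.mk_Iio_lt i (by simp)
    have hex : ∃ q, P (p '' Set.Iio i) (t i) q := exists_insert hκ hA hC hcard hi (t i)
    rw [hp i]
    simp only [next, dif_pos hex]
    exact hex.choose_spec
  have hIic : ∀ i, IsMatching (BooleanSubalgebra.closure (p '' Set.Iio i)) →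
      IsMatching (BooleanSubalgebra.closure (p '' Set.Iic i)) := by
    intro i hi
    rw [← Set.Iio_insert, Set.image_insert_eq]
    exact (hstep i hi).2.2
  have hIio : ∀ i, IsMatching (BooleanSubalgebra.closure (p '' Set.Iio i)) := by
    intro i
    induction i using wf.induction with
    | _ i ih => exact hdir _ fun j hj ↦ hIic j (ih j hj)
  refine ⟨p, fun i ↦ (hstep i (hIio i)).1, fun i ↦ (hstep i (hIio i)).2.1, ?_⟩
  rw [← Set.image_univ]
  exact hdir _ fun i _ ↦ hIic i (hIio i)

/-- **Maharam's theorem**, homogeneous case. -/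
theorem exists_orderIso_of_homogeneous (hκ : ℵ₀ ≤ κ)
    (hA : ∀ a : A, a ≠ ⊥ → κ ≤ density (Set.Iic a)) (hC : ∀ c : C, c ≠ ⊥ → κ ≤ density (Set.Iic c))
    (hA' : density A ≤ κ) (hC' : density C ≤ κ) (htop : ms (⊤ : A) = ms (⊤ : C)) :
    ∃ e : A ≃o C, ∀ a, ms (e a) = ms a := by
  obtain ⟨X, hX, hXκ⟩ := exists_dense A
  obtain ⟨Y, hY, hYκ⟩ := exists_dense C
  have hcard : #(X ⊕ Y) ≤ #κ.ord.ToType := by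
    rw [Cardinal.mk_sum, Cardinal.lift_id, Cardinal.lift_id, Cardinal.mk_ord_toType, hXκ, hYκ]
    exact Cardinal.add_le_of_le hκ hA' hC'
  obtain ⟨emb⟩ := Cardinal.le_def _ _ |>.1 hcard
  have : Nonempty X := hX.nonempty.to_subtype
  -- The indices below `κ.ord` enumerate both dense sets, possibly with repetitions, so every member
  -- of each receives a partner.
  have hsurj := Function.invFun_surjective emb.injective
  obtain ⟨p, hp1, hp2, hp⟩ := exists_matching_family hκ hA hC htop
    fun i ↦ Sum.map (↑) (↑) (Function.invFun emb i)
  set S := BooleanSubalgebra.closure (Set.range p)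
  set T := S.topologicalClosure continuous_compl_prod
  have hTm : IsMatching T := hp.topologicalClosure
  have hTc : IsClosed (T : Set (A × C)) := isClosed_closure
  have hpT : ∀ i, p i ∈ T := fun i ↦
    _root_.subset_closure (BooleanSubalgebra.subset_closure ⟨i, rfl⟩)
  refine hTm.exists_orderIso (fun a ↦ ?_) fun c ↦ ?_
  -- The domain of the closed matching is closed and contains the dense set `X`, hence is
  -- everything.
  · have hcl : IsClosed (sndImage (swap T) : Set A) :=
      hTm.swap.isClosed_sndImage (hTc.preimage continuous_swap)
    refine mem_sndImage.1 (closure_minimal (fun x hx ↦ ?_) hcl (hX a))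
    obtain ⟨i, hi⟩ := hsurj (.inl ⟨x, hx⟩)
    exact mem_sndImage.2 ⟨(p i).2, mem_swap.2 (hp1 i x (by simp [hi]) ▸ hpT i)⟩
  · have hcl : IsClosed (sndImage T : Set C) := hTm.isClosed_sndImage hTc
    refine mem_sndImage.1 (closure_minimal (fun x hx ↦ ?_) hcl (hY c))
    obtain ⟨i, hi⟩ := hsurj (.inr ⟨x, hx⟩)
    exact mem_sndImage.2 ⟨(p i).1, hp2 i x (by simp [hi]) ▸ hpT i⟩

end Maharam

end MeasureAlgebra

namespace MeasureAlgebra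

open Filter Topology

/-! ### Stability of density bounds -/

section Density

theorem density_le_of_surjective {X Y : Type u} [TopologicalSpace X] [TopologicalSpace Y] {f : X → Y}
    (hf : Continuous f) (hs : Function.Surjective f) : density Y ≤ density X := by
  obtain ⟨s, hs', hcard⟩ := exists_dense X
  rw [← hcard]
  exact (density_le (hs.denseRange.dense_image hf hs')).trans Cardinal.mk_image_le

theorem density_prod_le (X Y : Type u) [TopologicalSpace X] [TopologicalSpace Y] :
    density (X × Y) ≤ density X * density Y := by
  obtain ⟨s, hs, hs'⟩ := exists_dense X
  obtain ⟨t, ht, ht'⟩ := exists_dense Y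
  refine (density_le (hs.prod ht)).trans ?_
  rw [← hs', ← ht', Cardinal.mk_setProd]

variable {B : Type u} [BooleanAlgebra B] [MetricSpace B] [MeasureAlgebra B]

theorem density_Iic_mono {a b : B} (h : a ≤ b) : density (Set.Iic a) ≤ density (Set.Iic b) :=
  density_le_of_surjective (f := fun x : Set.Iic b ↦ (⟨x.1 ⊓ a, inf_le_right⟩ : Set.Iic a))
    ((continuous_subtype_val.inf continuous_const).subtype_mk _)
    fun x ↦ ⟨⟨x.1, x.2.trans h⟩, Subtype.ext (inf_eq_left.2 x.2)⟩

/-- Every `z ≤ x ⊔ y` is the join of its traces on `x` and `y`, and `κ * κ = κ`. -/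
theorem supClosed_density_le {κ : Cardinal.{u}} (hκ : ℵ₀ ≤ κ) :
    SupClosed {b : B | density (Set.Iic b) ≤ κ} := by
  intro x hx y hy
  have h1 : density (Set.Iic (x ⊔ y)) ≤ density (Set.Iic x × Set.Iic y) :=
    density_le_of_surjective
      (f := fun p : Set.Iic x × Set.Iic y ↦
        (⟨p.1.1 ⊔ p.2.1, sup_le_sup p.1.2 p.2.2⟩ : Set.Iic (x ⊔ y)))
      (((continuous_subtype_val.comp continuous_fst).sup
        (continuous_subtype_val.comp continuous_snd)).subtype_mk _)
      fun z ↦ ⟨(⟨z.1 ⊓ x, inf_le_right⟩, ⟨z.1 ⊓ y, inf_le_right⟩), Subtype.ext <| by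
        change z.1 ⊓ x ⊔ z.1 ⊓ y = z.1
        rw [← inf_sup_left, inf_eq_left]
        exact z.2⟩
  exact h1.trans ((density_prod_le _ _).trans ((mul_le_mul' hx hy).trans
    (Cardinal.mul_eq_self hκ).le))

/-- If `f n` tends to `x`, the traces on `x` of dense subsets of the ideals of all `f n` are
together dense below `x`; countably many sets of size at most `κ` suffice. -/
theorem isClosed_density_le {κ : Cardinal.{u}} (hκ : ℵ₀ ≤ κ) :
    IsClosed {b : B | density (Set.Iic b) ≤ κ} := by
  refine isClosed_of_closure_subset fun x hx ↦ ?_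
  obtain ⟨f, hf, hfx⟩ := mem_closure_iff_seq_limit.1 hx
  choose D hD hDκ using fun n ↦ exists_dense (Set.Iic (f n))
  let s : Set (Set.Iic x) := ⋃ n : ULift.{u} ℕ,
    (fun d : Set.Iic (f n.down) ↦ (⟨x ⊓ d.1, inf_le_left⟩ : Set.Iic x)) '' D n.down
  have hs : Dense s := by
    intro y
    refine Metric.mem_closure_iff.2 fun ε hε ↦ ?_
    obtain ⟨n, hn⟩ := (Metric.tendsto_atTop.1 hfx (ε / 2) (half_pos hε))
    have hn := hn n le_rfl
    obtain ⟨d, hd, hyd⟩ := Metric.mem_closure_iff.1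
      (hD n ⟨y.1 ⊓ f n, inf_le_right⟩) (ε / 2) (half_pos hε)
    refine ⟨⟨x ⊓ d.1, inf_le_left⟩, Set.mem_iUnion.2 ⟨⟨n⟩, d, hd, rfl⟩, ?_⟩
    have h1 : dist y.1 (x ⊓ d.1) ≤ dist y.1 d.1 := by
      conv_lhs => rw [← inf_eq_left.2 y.2, inf_comm x]
      exact dist_le_dist_inf _ _ _
    have h2 : dist y.1 (y.1 ⊓ f n) ≤ dist (f n) x := by
      conv_lhs => rw [← inf_eq_left.2 y.2, inf_assoc, inf_comm y.1, inf_comm y.1]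
      rw [dist_comm (f n)]
      refine (dist_le_dist_inf _ _ _).trans ?_
      have := dist_le_dist_inf x (f n) x
      rwa [inf_idem, inf_comm (f n)] at this
    have h3 : dist (y.1 ⊓ f n) d.1 < ε / 2 := hyd
    change dist y.1 (x ⊓ d.1) < ε
    linarith [dist_triangle y.1 (y.1 ⊓ f n) d.1]
  refine (density_le hs).trans ((Cardinal.mk_iUnion_le _).trans ?_)
  refine (mul_le_mul' (b := κ) (d := κ) ?_ (ciSup_le' fun n ↦ ?_)).trans (Cardinal.mul_eq_self hκ).le
  · simpa using hκ
  · exact Cardinal.mk_image_le.trans ((hDκ _).trans_le (hf _))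

end Density

/-! ### Principal ideals as measure algebras -/

section Ideal

variable {B : Type*} [BooleanAlgebra B]

/-- A principal ideal of a Boolean algebra is a Boolean algebra, with the relative complement. -/
instance instBooleanAlgebraIic (a : B) : BooleanAlgebra (Set.Iic a) where
  __ := (inferInstance : Lattice (Set.Iic a))
  __ := (inferInstance : BoundedOrder (Set.Iic a))
  le_sup_inf x y z := @le_sup_inf B _ x.1 y.1 z.1
  compl x := ⟨a \ x.1, sdiff_le⟩
  inf_compl_le_bot x := (disjoint_sdiff_self_right (x := x.1) (y := a)).le_bot
  top_le_sup_compl x := (sup_sdiff_cancel_right (show x.1 ≤ a from x.2)).ge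

variable [MetricSpace B] [MeasureAlgebra B]

instance (a : B) : MeasureAlgebra (Set.Iic a) where
  dist_eq' x y := dist_eq' x.1 y.1
  modular' x y := modular' x.1 y.1

instance (a : B) [CompleteSpace B] : CompleteSpace (Set.Iic a) :=
  (isClosed_Iic (a := a)).isComplete.completeSpace_coe

end Ideal

/-- Homogeneous principal ideals with the same density and the same measure are isomorphic. -/
theorem exists_orderIso_Iic {B C : Type u} [BooleanAlgebra B] [MetricSpace B] [MeasureAlgebra B]
    [CompleteSpace B] [BooleanAlgebra C] [MetricSpace C] [MeasureAlgebra C] [CompleteSpace C]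
    {κ : Cardinal.{u}} (hκ : ℵ₀ ≤ κ) {b : B} {c : C}
    (hb : ∀ x ≤ b, x ≠ ⊥ → density (Set.Iic x) = κ) (hc : ∀ x ≤ c, x ≠ ⊥ → density (Set.Iic x) = κ)
    (hb0 : b ≠ ⊥) (hc0 : c ≠ ⊥) (h : ms b = ms c) :
    ∃ e : Set.Iic b ≃o Set.Iic c, ∀ x, ms (e x : C) = ms (x : B) := by
  have key : ∀ {X : Type u} [BooleanAlgebra X] [MetricSpace X] [MeasureAlgebra X] (b : X),
      (∀ x ≤ b, x ≠ ⊥ → density (Set.Iic x) = κ) →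
      ∀ x : Set.Iic b, x ≠ ⊥ → κ ≤ density (Set.Iic x) := by
    intro X _ _ _ b hb x hx
    rw [← hb x.1 x.2 fun h ↦ hx (Subtype.ext h)]
    exact density_le_of_surjective
      (f := fun y : Set.Iic x ↦ (⟨y.1.1, y.2⟩ : Set.Iic x.1))
      ((continuous_subtype_val.comp continuous_subtype_val).subtype_mk _)
      fun y ↦ ⟨⟨⟨y.1, le_trans y.2 x.2⟩, y.2⟩, rfl⟩
  exact exists_orderIso_of_homogeneous hκ (key b hb) (key c hc) (hb b le_rfl hb0).le
    (hc c le_rfl hc0).le h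

/-! ### Gluing along partitions of unity -/

section Gluing

variable {B C : Type*} [BooleanAlgebra B] [MetricSpace B] [MeasureAlgebra B]
    [CompleteSpace B] [BooleanAlgebra C] [MetricSpace C] [MeasureAlgebra C] [CompleteSpace C]

omit [MetricSpace B] [MeasureAlgebra B] [CompleteSpace B] in
theorem inf_eq_of_isLUB {ι : Type*} {c z : ι → B} (hc : Pairwise (Function.onFun Disjoint c))
    (hz : ∀ i, z i ≤ c i) {u : B} (hu : IsLUB (Set.range z) u) (i : ι) : u ⊓ c i = z i := by
  refine le_antisymm ?_ (le_inf (hu.1 ⟨i, rfl⟩) (hz i))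
  have h1 : u ≤ z i ⊔ (c i)ᶜ := hu.2 <| by
    rintro _ ⟨j, rfl⟩
    by_cases hij : j = i
    · exact hij ▸ le_sup_left
    · exact ((hz j).trans (le_compl_iff_disjoint_right.2 (hc hij))).trans le_sup_right
  calc u ⊓ c i ≤ (z i ⊔ (c i)ᶜ) ⊓ c i := inf_le_inf_right _ h1
    _ = z i ⊓ c i := by rw [inf_sup_right]; simp
    _ ≤ z i := inf_le_left

omit [MetricSpace B] [MeasureAlgebra B] [CompleteSpace B] in
theorem le_of_forall_inf_le {ι : Type*} {a : ι → B} (ha : IsLUB (Set.range a) ⊤) {x y : B}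
    (h : ∀ i, x ⊓ a i ≤ y ⊓ a i) : x ≤ y := by
  have h1 : (⊤ : B) ≤ xᶜ ⊔ y := ha.2 <| by
    rintro _ ⟨i, rfl⟩
    have h2 : a i = a i ⊓ xᶜ ⊔ x ⊓ a i := by rw [inf_comm x, ← inf_sup_left]; simp
    rw [h2]
    exact sup_le_sup inf_le_right ((h i).trans inf_le_left)
  calc x = x ⊓ (xᶜ ⊔ y) := by rw [top_le_iff.1 h1, inf_top_eq]
    _ = x ⊓ y := by rw [inf_sup_left]; simp
    _ ≤ y := inf_le_right

omit [MetricSpace B] [MeasureAlgebra B] [CompleteSpace B] in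
theorem eq_of_forall_inf_eq {ι : Type*} {a : ι → B} (ha : IsLUB (Set.range a) ⊤) {x y : B}
    (h : ∀ i, x ⊓ a i = y ⊓ a i) : x = y :=
  (le_of_forall_inf_le ha fun i ↦ (h i).le).antisymm (le_of_forall_inf_le ha fun i ↦ (h i).ge)

omit [MetricSpace B] [MeasureAlgebra B] [CompleteSpace B] in
theorem isLUB_inf {ι : Type*} {a : ι → B} (ha : IsLUB (Set.range a) ⊤) (x : B) :
    IsLUB (Set.range fun i ↦ x ⊓ a i) x := by
  refine ⟨by rintro _ ⟨i, rfl⟩; exact inf_le_left, fun u hu ↦ le_of_forall_inf_le ha fun i ↦ ?_⟩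
  exact le_inf (hu ⟨i, rfl⟩) inf_le_right

theorem hasSum_ms_inf {ι : Type*} {a : ι → B} (hd : Pairwise (Function.onFun Disjoint a))
    (ha : IsLUB (Set.range a) ⊤) (x : B) : HasSum (fun i ↦ ms (x ⊓ a i)) (ms x) :=
  hasSum_ms (fun _ _ hij ↦ (hd hij).mono inf_le_right inf_le_right) (isLUB_inf ha x)

/-- Measure-preserving isomorphisms between the members of two partitions of unity can be glued. -/
theorem exists_orderIso_of_partition {ι : Type*} {a : ι → B} {c : ι → C}
    (had : Pairwise (Function.onFun Disjoint a)) (ha : IsLUB (Set.range a) ⊤)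
    (hcd : Pairwise (Function.onFun Disjoint c)) (hc : IsLUB (Set.range c) ⊤)
    (h : ∀ i, ∃ e : Set.Iic (a i) ≃o Set.Iic (c i), ∀ x, ms (e x : C) = ms (x : B)) :
    ∃ e : B ≃o C, ∀ x, ms (e x) = ms x := by
  choose e he using h
  let tr : ∀ i, B → Set.Iic (a i) := fun i x ↦ ⟨x ⊓ a i, inf_le_right⟩
  let tr' : ∀ i, C → Set.Iic (c i) := fun i x ↦ ⟨x ⊓ c i, inf_le_right⟩
  -- The image of `x` is the join of the images of its traces; by disjointness its trace on `c i` is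
  -- exactly the `i`-th image.
  choose f hf using fun x : B ↦ exists_isLUB (Set.range fun i ↦ (e i (tr i x) : C))
  choose g hg using fun y : C ↦ exists_isLUB (Set.range fun i ↦ ((e i).symm (tr' i y) : B))
  have hf' : ∀ x i, tr' i (f x) = e i (tr i x) := fun x i ↦
    Subtype.ext (inf_eq_of_isLUB hcd (fun i ↦ (e i (tr i x)).2) (hf x) i)
  have hg' : ∀ y i, tr i (g y) = (e i).symm (tr' i y) := fun y i ↦
    Subtype.ext (inf_eq_of_isLUB had (fun i ↦ ((e i).symm (tr' i y)).2) (hg y) i)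
  refine ⟨⟨⟨f, g, fun x ↦ ?_, fun y ↦ ?_⟩, fun {x y} ↦ ?_⟩, fun x ↦ ?_⟩
  · refine eq_of_forall_inf_eq ha fun i ↦ congrArg Subtype.val (?_ : tr i (g (f x)) = tr i x)
    rw [hg', hf', OrderIso.symm_apply_apply]
  · refine eq_of_forall_inf_eq hc fun i ↦ congrArg Subtype.val (?_ : tr' i (f (g y)) = tr' i y)
    rw [hf', hg', OrderIso.apply_symm_apply]
  · change f x ≤ f y ↔ x ≤ y
    constructor <;> intro hxy
    · refine le_of_forall_inf_le ha fun i ↦ (?_ : tr i x ≤ tr i y)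
      rw [← (e i).le_iff_le, ← hf', ← hf']
      exact inf_le_inf_right _ hxy
    · refine le_of_forall_inf_le hc fun i ↦ (?_ : tr' i (f x) ≤ tr' i (f y))
      rw [hf', hf', (e i).le_iff_le]
      exact inf_le_inf_right _ hxy
  · change ms (f x) = ms x
    have h1 := hasSum_ms_inf hcd hc (f x)
    have h2 : ∀ i, ms (f x ⊓ c i) = ms (x ⊓ a i) := fun i ↦ by
      have := he i (tr i x)
      rwa [← hf'] at this
    simp only [h2] at h1
    exact h1.unique (hasSum_ms_inf had ha x)

end Gluing

end MeasureAlgebra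

namespace ProbabilityAlgebra

open MeasureAlgebra

/-! ### Atoms and homogeneous parts -/

section Decomposition

variable {B : Type u} [ProbabilityAlgebra B]

theorem dist_bot_eq_μ (x : B) : dist x ⊥ = μ x := by rw [dist_eq_μ, symmDiff_bot]

theorem μ_sup_add_inf (x y : B) : μ (x ⊔ y) + μ (x ⊓ y) = μ x + μ y := by
  linarith [μ_sub_inf x y]

instance : MeasureAlgebra B where
  modular' x y := by simpa only [dist_bot_eq_μ] using μ_sup_add_inf x y
  dist_eq' x y := by
    rw [dist_bot_eq_μ, dist_bot_eq_μ, dist_eq_μ, symmDiff_eq_sup_sdiff_inf]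
    have h1 := μ_sup_add_inf ((x ⊔ y) \ (x ⊓ y)) (x ⊓ y)
    have h2 : (x ⊔ y) \ (x ⊓ y) ⊔ (x ⊓ y) = x ⊔ y := sdiff_sup_cancel (inf_le_left.trans le_sup_left)
    rw [disjoint_sdiff_self_left.eq_bot, μ_bot, h2] at h1
    linarith

theorem ms_eq_μ (x : B) : ms x = μ x := dist_bot_eq_μ x

theorem μ_le_one (x : B) : μ x ≤ 1 := by
  rw [← ms_eq_μ, ← μ_top (B := B), ← ms_eq_μ]
  exact ms_mono le_top

theorem μ_pos {x : B} (hx : x ≠ ⊥) : 0 < μ x := by rw [← ms_eq_μ]; exact ms_pos.2 hx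

theorem eltDensity_mono {a b : B} (h : a ≤ b) : eltDensity a ≤ eltDensity b := density_Iic_mono h

theorem IsAtomless.mono {a b : B} (hb : IsAtomless b) (h : a ≤ b) : IsAtomless a :=
  fun x hx ↦ hb x (hx.trans h)

theorem IsAtomless.not_isAtom {a b : B} (hb : IsAtomless b) (h : a ≤ b) : ¬ IsAtom a := by
  intro ha
  obtain ⟨a₁, a₂, h1, h2, hd, rfl⟩ := hb a h ha.1
  have h3 : a₁ = a₁ ⊔ a₂ := (ha.le_iff.1 le_sup_left).resolve_left h1
  have h4 : a₂ ≤ a₁ := by rw [h3]; exact le_sup_right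
  exact h2 (le_bot_iff.1 (hd h4 le_rfl))

theorem isAtomless_of_forall_not_isAtom {b : B} (h : ∀ a ≤ b, ¬ IsAtom a) : IsAtomless b := by
  intro a hab ha
  have h1 := h a hab
  simp only [IsAtom, not_and, not_forall] at h1
  obtain ⟨x, hx, hx0⟩ := h1 ha
  refine ⟨x, a \ x, hx0, fun h2 ↦ hx.not_ge (sdiff_eq_bot_iff.1 h2), disjoint_sdiff_self_right,
    sup_sdiff_cancel_right hx.le⟩

/-- A finite dense set is closed, so the ideal would be finite, and a minimal nonzero element of it
would be an atom. -/
theorem IsAtomless.aleph0_le_eltDensity {b : B} (hb : IsAtomless b) (h0 : b ≠ ⊥) :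
    ℵ₀ ≤ eltDensity b := by
  by_contra! hlt
  obtain ⟨s, hs, hcard⟩ := exists_dense (Set.Iic b)
  have hfin : s.Finite := Cardinal.lt_aleph0_iff_set_finite.1 (hcard.trans_lt hlt)
  have huniv : s = Set.univ := by rw [← hs.closure_eq, hfin.isClosed.closure_eq]
  have hfin' : (Set.Iic b).Finite := Set.finite_coe_iff.1 (Set.finite_univ_iff.1 (huniv ▸ hfin))
  obtain ⟨a, ha⟩ := (hfin'.subset (t := {a | a ≤ b ∧ a ≠ ⊥}) fun a ha ↦ ha.1).exists_minimal
    ⟨b, le_rfl, h0⟩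
  refine hb.not_isAtom ha.prop.1 ⟨ha.prop.2, fun x hx ↦ ?_⟩
  by_contra hx0
  exact hx.not_ge (ha.le_of_le ⟨hx.le.trans ha.prop.1, hx0⟩ hx.le)

/-- Every nonzero element contains a homogeneous one. -/
theorem exists_isHomogeneous_le {b : B} (hb : b ≠ ⊥) : ∃ h ≤ b, IsHomogeneous h := by
  -- A nonzero element of least density is homogeneous, since density is monotone.
  obtain ⟨h, ⟨hle, h0⟩, hmin⟩ := exists_minimalFor_of_wellFoundedLT
    (fun x : B ↦ x ≤ b ∧ x ≠ ⊥) eltDensity ⟨b, le_rfl, hb⟩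
  exact ⟨h, hle, h0, fun a ha ha0 ↦ (eltDensity_mono ha).antisymm
    (hmin ⟨ha.trans hle, ha0⟩ (eltDensity_mono ha))⟩

variable (B) in
/-- The join of the atomless homogeneous elements of density `κ`. -/
noncomputable def homogeneousPart (κ : Cardinal.{u}) : B :=
  (exists_isLUB {b : B | IsAtomless b ∧ IsHomogeneous b ∧ eltDensity b = κ}).choose

theorem isLUB_homogeneousPart (κ : Cardinal.{u}) :
    IsLUB {b : B | IsAtomless b ∧ IsHomogeneous b ∧ eltDensity b = κ} (homogeneousPart B κ) :=
  (exists_isLUB {b : B | IsAtomless b ∧ IsHomogeneous b ∧ eltDensity b = κ}).choose_spec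

theorem exists_inf_ne_bot {S : Set B} {t a : B} (ht : IsLUB S t) (hat : a ≤ t) (ha : a ≠ ⊥) :
    ∃ s ∈ S, a ⊓ s ≠ ⊥ := by
  by_contra! h
  exact ha (le_bot_iff.1 (disjoint_of_isLUB ht (fun s hs ↦ disjoint_iff.2 (h s hs)) le_rfl hat))

theorem isAtomless_homogeneousPart (κ : Cardinal.{u}) : IsAtomless (homogeneousPart B κ) := by
  refine isAtomless_of_forall_not_isAtom fun a ha hatom ↦ ?_
  obtain ⟨s, hs, hne⟩ := exists_inf_ne_bot (isLUB_homogeneousPart κ) ha hatom.1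
  have h1 : a ⊓ s = a := (hatom.le_iff.1 inf_le_left).resolve_left hne
  exact hs.1.not_isAtom (inf_eq_left.1 h1) hatom

/-- The upper bound passes to the join because the elements of density at most `κ` form a closed set
stable under joins. For the lower bound, `a` meets some homogeneous element of density `κ` in a
nonzero element, again of density `κ`. -/
theorem eltDensity_of_le_homogeneousPart {κ : Cardinal.{u}} (hκ : κ ∈ maharamK B) {a : B}
    (ha : a ≤ homogeneousPart B κ) (h0 : a ≠ ⊥) : eltDensity a = κ := by
  obtain ⟨h1, h2⟩ := hκ
  refine le_antisymm ((eltDensity_mono ha).trans ?_) ?_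
  · exact isLUB_mem h2 (fun b hb ↦ hb.2.2.le) (supClosed_density_le h1) (isClosed_density_le h1)
      (isLUB_homogeneousPart κ)
  · obtain ⟨s, hs, hne⟩ := exists_inf_ne_bot (isLUB_homogeneousPart κ) ha h0
    rw [← hs.2.2, ← hs.2.1.2 _ inf_le_right hne]
    exact eltDensity_mono inf_le_left

theorem homogeneousPart_ne_bot {κ : Cardinal.{u}} (hκ : κ ∈ maharamK B) :
    homogeneousPart B κ ≠ ⊥ := by
  obtain ⟨_, b, hb⟩ := hκ
  exact fun h ↦ hb.2.1.1 (le_bot_iff.1 (h ▸ (isLUB_homogeneousPart κ).1 hb))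

theorem isHomogeneous_homogeneousPart {κ : Cardinal.{u}} (hκ : κ ∈ maharamK B) :
    IsHomogeneous (homogeneousPart B κ) :=
  ⟨homogeneousPart_ne_bot hκ, fun _ ha h0 ↦ (eltDensity_of_le_homogeneousPart hκ ha h0).trans
    (eltDensity_of_le_homogeneousPart hκ le_rfl (homogeneousPart_ne_bot hκ)).symm⟩

theorem maharamΨ_eq {κ : Cardinal.{u}} (hκ : κ ∈ maharamK B) :
    maharamΨ B κ = μ (homogeneousPart B κ) := by
  refine IsGreatest.csSup_eq ⟨⟨_, isAtomless_homogeneousPart κ, isHomogeneous_homogeneousPart hκ,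
    eltDensity_of_le_homogeneousPart hκ le_rfl (homogeneousPart_ne_bot hκ), rfl⟩, ?_⟩
  rintro _ ⟨b, h1, h2, h3, rfl⟩
  rw [← ms_eq_μ, ← ms_eq_μ]
  exact ms_mono ((isLUB_homogeneousPart κ).1 ⟨h1, h2, h3⟩)

variable (B) in
/-- The join of the atoms. -/
noncomputable def atomicPart : B := (exists_isLUB {a : B | IsAtom a}).choose

theorem isAtomicPart_atomicPart : IsAtomicPart (atomicPart B) :=
  (exists_isLUB {a : B | IsAtom a}).choose_spec

theorem pairwise_disjoint_atoms :
    Pairwise (Function.onFun Disjoint fun a : {a : B // IsAtom a} ↦ a.1) :=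
  fun a b hab ↦ a.2.disjoint_of_ne b.2 fun h ↦ hab (Subtype.ext h)

theorem isLUB_range_atoms : IsLUB (Set.range fun a : {a : B // IsAtom a} ↦ a.1) (atomicPart B) := by
  rw [Subtype.range_coe_subtype]
  exact isAtomicPart_atomicPart

theorem hasSum_atoms : HasSum (fun a : {a : B // IsAtom a} ↦ μ a.1) (μ (atomicPart B)) := by
  simpa only [ms_eq_μ] using hasSum_ms pairwise_disjoint_atoms (isLUB_range_atoms (B := B))

theorem pairwise_disjoint_homogeneousPart :
    Pairwise (Function.onFun Disjoint fun κ : maharamK B ↦ homogeneousPart B κ) := by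
  intro κ l hne
  by_contra hcon
  rw [Function.onFun, disjoint_iff] at hcon
  exact hne (Subtype.ext ((eltDensity_of_le_homogeneousPart κ.2 inf_le_left hcon).symm.trans
    (eltDensity_of_le_homogeneousPart l.2 inf_le_right hcon)))

theorem IsAtomless.disjoint_atom {a b : B} (hb : IsAtomless b) (ha : IsAtom a) : Disjoint b a := by
  rw [disjoint_iff, inf_comm]
  by_contra h
  exact hb.not_isAtom (inf_eq_left.1 ((ha.le_iff.1 inf_le_left).resolve_left h)) ha

theorem isLUB_range_homogeneousPart :
    IsLUB (Set.range fun κ : maharamK B ↦ homogeneousPart B κ) (atomicPart B)ᶜ := by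
  refine ⟨?_, fun u hu ↦ ?_⟩
  · rintro _ ⟨κ, rfl⟩
    exact le_compl_iff_disjoint_right.2 (disjoint_of_isLUB isAtomicPart_atomicPart
      fun a ha ↦ (isAtomless_homogeneousPart κ.1).disjoint_atom ha)
  · rw [← sdiff_eq_bot_iff]
    by_contra h0
    -- A remainder outside all parts would be atomless and contain a homogeneous element, which
    -- already lies in the part of its own density.
    have hatomless : IsAtomless ((atomicPart B)ᶜ \ u) :=
      isAtomless_of_forall_not_isAtom fun a ha hatom ↦ hatom.1 <| le_bot_iff.1 <|
        (disjoint_compl_right (a := atomicPart B)) (isAtomicPart_atomicPart.1 hatom)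
          (ha.trans sdiff_le)
    obtain ⟨h, hle, hh⟩ := exists_isHomogeneous_le h0
    have hha := hatomless.mono hle
    have hκ : eltDensity h ∈ maharamK B := ⟨hha.aleph0_le_eltDensity hh.1, h, hha, hh, rfl⟩
    have h1 : h ≤ homogeneousPart B (eltDensity h) := (isLUB_homogeneousPart _).1 ⟨hha, hh, rfl⟩
    have h2 : h ≤ u := h1.trans (hu ⟨⟨_, hκ⟩, rfl⟩)
    exact hh.1 (le_bot_iff.1 (disjoint_sdiff_self_right h2 hle))

theorem hasSum_maharamΨ :
    HasSum (fun κ : maharamK B ↦ maharamΨ B κ) (μ (atomicPart B)ᶜ) := by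
  have := hasSum_ms pairwise_disjoint_homogeneousPart (isLUB_range_homogeneousPart (B := B))
  simpa only [ms_eq_μ, maharamΨ_eq (Subtype.prop _)] using this

theorem maharamΨ_mem_Ioc {κ : Cardinal.{u}} (hκ : κ ∈ maharamK B) :
    maharamΨ B κ ∈ Set.Ioc (0 : ℝ) 1 := by
  rw [maharamΨ_eq hκ]
  exact ⟨μ_pos (homogeneousPart_ne_bot hκ), μ_le_one _⟩

variable (B) in
-- A summable family has countable support, and here all terms are positive.
theorem countable_maharamK : (maharamK B).Countable := by
  have h1 := (hasSum_maharamΨ (B := B)).summable.countable_support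
  have h2 : (Function.support fun κ : maharamK B ↦ maharamΨ B κ) = Set.univ :=
    Set.eq_univ_of_forall fun κ ↦ (maharamΨ_mem_Ioc κ.2).1.ne'
  rw [h2, Set.countable_univ_iff] at h1
  exact h1

end Decomposition

end ProbabilityAlgebra

namespace ProbabilityAlgebra

open MeasureAlgebra Filter Topology

/-! ### Matching positive functions by their superlevel sets -/

section LevelSets

theorem eventually_le_of_lt {X : Type*} {k : X → ℝ} {r : ℝ} (hfin : {x | r ≤ k x}.Finite) :
    ∀ᶠ s in 𝓝[>] r, ∀ x, r < k x → s ≤ k x := by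
  have h1 : ∀ᶠ s in 𝓝[>] r, ∀ x ∈ {x | r ≤ k x}, r < k x → s ≤ k x := by
    refine (eventually_all_finite hfin).2 fun x _ ↦ ?_
    by_cases hx : r < k x
    · filter_upwards [Ioo_mem_nhdsGT hx] with s hs _ using hs.2.le
    · exact Eventually.of_forall fun s hs ↦ absurd hs hx
  filter_upwards [h1] with s hs x hx using hs x hx.le hx

/-- Positive functions whose superlevel sets are finite and have the same cardinality agree up to
a bijection. -/
theorem exists_equiv_of_ncard_superlevel_eq {I J : Type*} {f : I → ℝ} {g : J → ℝ}
    (hf : ∀ i, 0 < f i) (hg : ∀ j, 0 < g j) (hf' : ∀ r > 0, {i | r ≤ f i}.Finite)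
    (hg' : ∀ r > 0, {j | r ≤ g j}.Finite)
    (h : ∀ r > 0, {i | r ≤ f i}.ncard = {j | r ≤ g j}.ncard) :
    ∃ e : I ≃ J, ∀ i, g (e i) = f i := by
  have hfib : ∀ r, Nonempty ({i // f i = r} ≃ {j // g j = r}) := by
    intro r
    rcases le_or_gt r 0 with hr | hr
    · have : IsEmpty {i // f i = r} := ⟨fun i ↦ (hf i.1).not_ge (i.2.trans_le hr)⟩
      have : IsEmpty {j // g j = r} := ⟨fun i ↦ (hg i.1).not_ge (i.2.trans_le hr)⟩
      exact ⟨Equiv.equivOfIsEmpty _ _⟩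
    -- Finiteness provides `s > r` with no values of `f` or `g` strictly between, so each fibre over
    -- `r` is a difference of two superlevel sets.
    · obtain ⟨s, ⟨hs1, hs2⟩, hs⟩ := (((eventually_le_of_lt (hf' r hr)).and (eventually_le_of_lt (hg' r hr))).and
        (self_mem_nhdsWithin (s := Set.Ioi r))).exists
      have hs : r < s := hs
      have h1 : {i | f i = r} = {i | r ≤ f i} \ {i | s ≤ f i} := by
        ext i
        simp only [Set.mem_ofPred_eq, Set.mem_sdiff, not_le]
        refine ⟨fun h ↦ ⟨h.ge, h.trans_lt hs⟩, fun h ↦ ?_⟩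
        exact (h.1.eq_of_not_lt fun h' ↦ (hs1 i h').not_gt h.2).symm
      have h2 : {i | g i = r} = {i | r ≤ g i} \ {i | s ≤ g i} := by
        ext i
        simp only [Set.mem_ofPred_eq, Set.mem_sdiff, not_le]
        refine ⟨fun h ↦ ⟨h.ge, h.trans_lt hs⟩, fun h ↦ ?_⟩
        exact (h.1.eq_of_not_lt fun h' ↦ (hs2 i h').not_gt h.2).symm
      have h3 : {i | f i = r}.ncard = {j | g j = r}.ncard := by
        rw [h1, h2, Set.ncard_sdiff (show {i | s ≤ f i} ⊆ {i | r ≤ f i} from fun i hi ↦ hs.le.trans hi) (hf' s (hr.trans hs)),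
          Set.ncard_sdiff (show {i | s ≤ g i} ⊆ {i | r ≤ g i} from fun i hi ↦ hs.le.trans hi) (hg' s (hr.trans hs)), h r hr,
          h s (hr.trans hs)]
      have h4 : Finite {i // f i = r} := ((hf' r hr).subset fun i hi ↦ Eq.ge hi).to_subtype
      have h5 : Finite {j // g j = r} := ((hg' r hr).subset fun i hi ↦ Eq.ge hi).to_subtype
      exact Finite.card_eq.1 h3
  exact ⟨Equiv.ofFiberEquiv fun r ↦ (hfib r).some, fun i ↦ Equiv.ofFiberEquiv_map _ i⟩

end LevelSets

/-! ### The enumeration of atom measures -/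

section AtomSizes

variable {B : Type u} [ProbabilityAlgebra B]

theorem finite_atoms {r : ℝ} (hr : 0 < r) : {a : {a : B // IsAtom a} | r ≤ μ a.1}.Finite := by
  have h := (hasSum_atoms (B := B)).summable.tendsto_cofinite_zero.eventually_lt_const hr
  simpa [eventually_cofinite] using h

theorem bddAbove_atomSizes (n : ℕ) : BddAbove (insert 0 {r : ℝ | ∃ s : Finset B, s.card = n + 1 ∧
    ∀ a ∈ s, IsAtom a ∧ r ≤ μ a}) := by
  refine ⟨1, ?_⟩
  rintro r (rfl | ⟨s, hs, h⟩)
  · exact zero_le_one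
  · obtain ⟨a, ha⟩ := Finset.card_pos.1 (n.succ_pos.trans_eq hs.symm)
    exact (h a ha).2.trans (μ_le_one a)

theorem atomSizes_nonneg (n : ℕ) : 0 ≤ atomSizes B n :=
  le_csSup (bddAbove_atomSizes n) (Set.mem_insert _ _)

theorem le_atomSizes_iff {n : ℕ} {r : ℝ} (hr : 0 < r) :
    r ≤ atomSizes B n ↔ n < {a : {a : B // IsAtom a} | r ≤ μ a.1}.ncard := by
  classical
  constructor
  · contrapose!
    intro hn
    -- A bound strictly below `r` is needed for the supremum. Only finitely many atoms have measure
    -- at least `r / 2`, so for `t` close to `r` every atom of measure at least `t` has measure at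
    -- least `r`.
    have hgap : ∀ᶠ t in 𝓝[<] r, ∀ a ∈ {a : {a : B // IsAtom a} | r / 2 ≤ μ a.1},
        μ a.1 < r → μ a.1 < t := by
      refine (eventually_all_finite (finite_atoms (half_pos hr))).2 fun a _ ↦ ?_
      by_cases ha : μ a.1 < r
      · filter_upwards [Ioo_mem_nhdsLT ha] with t ht _ using ht.1
      · exact Eventually.of_forall fun s hs ↦ absurd hs ha
    obtain ⟨t, ht, ht1, ht2⟩ := (hgap.and (Ioo_mem_nhdsLT (half_lt_self hr))).exists
    refine lt_of_le_of_lt (csSup_le (Set.insert_nonempty _ _) ?_) ht2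
    rintro x (rfl | ⟨s, hs, h⟩)
    · exact (half_pos hr).le.trans ht1.le
    · by_contra! hx
      have h1 : (s.subtype fun a ↦ IsAtom a : Set {a : B // IsAtom a}) ⊆ {a | r ≤ μ a.1} := by
        intro a ha
        have ha' : a.1 ∈ s := by simpa using ha
        have h2 := (h _ ha').2
        by_contra h3
        exact (ht a (by change r / 2 ≤ μ a.1; linarith) (not_le.1 h3)).not_ge (hx.le.trans h2)
      have h2 := Set.ncard_le_ncard h1 (finite_atoms hr)
      rw [Set.ncard_coe_finset, Finset.card_subtype,
        Finset.filter_true_of_mem fun a ha ↦ (h a ha).1] at h2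
      lia
  · intro hn
    obtain ⟨s, hs, hcard⟩ := Set.exists_subset_card_eq (Nat.succ_le_of_lt hn)
    have hfin := (finite_atoms hr).subset hs
    refine le_csSup (bddAbove_atomSizes n) (Or.inr ⟨hfin.toFinset.map (.subtype _), ?_, ?_⟩)
    · rw [Finset.card_map, ← Set.ncard_eq_toFinset_card s hfin, hcard]
    · intro a ha
      obtain ⟨b, hb, rfl⟩ := Finset.mem_map.1 ha
      exact ⟨b.2, hs (hfin.mem_toFinset.1 hb)⟩

variable (B) in
/-- `atomSizes` enumerates the measures of the atoms. -/
theorem exists_equiv_atoms : ∃ e : {n // 0 < atomSizes B n} ≃ {a : B // IsAtom a},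
    ∀ n, μ (e n).1 = atomSizes B n := by
  -- The superlevel sets of `atomSizes` are initial segments of `ℕ`, of length the number of atoms
  -- in the corresponding superlevel set.
  have himg : ∀ r > 0, (↑) '' {n : {n // 0 < atomSizes B n} | r ≤ atomSizes B n} =
      Set.Iio {a : {a : B // IsAtom a} | r ≤ μ a.1}.ncard := by
    intro r hr
    ext n
    rw [Set.mem_Iio, ← le_atomSizes_iff hr]
    constructor
    · rintro ⟨m, hm, rfl⟩
      exact hm
    · exact fun h ↦ ⟨⟨n, hr.trans_le h⟩, h, rfl⟩
  refine exists_equiv_of_ncard_superlevel_eq (f := fun n : {n // 0 < atomSizes B n} ↦ atomSizes B n)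
    (g := fun a : {a : B // IsAtom a} ↦ μ a.1) (fun n ↦ n.2) (fun a ↦ μ_pos a.2.1)
    (fun r hr ↦ ?_) (fun r hr ↦ finite_atoms hr) fun r hr ↦ ?_
  · exact Set.Finite.of_finite_image (himg r hr ▸ Set.finite_Iio _)
      Subtype.val_injective.injOn
  · rw [← Set.ncard_image_of_injective _ Subtype.val_injective, himg r hr, Set.ncard_eq_toFinset_card']
    simp

variable (B) in
theorem hasSum_atomSizes : HasSum (fun n ↦ atomSizes B n) (μ (atomicPart B)) := by
  obtain ⟨e, he⟩ := exists_equiv_atoms B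
  have h1 := (e.hasSum_iff (f := fun a : {a : B // IsAtom a} ↦ μ a.1)).2 hasSum_atoms
  have h2 : (fun a : {a : B // IsAtom a} ↦ μ a.1) ∘ e =
      atomSizes B ∘ ((↑) : {n | 0 < atomSizes B n} → ℕ) := funext he
  rw [h2] at h1
  exact (hasSum_subtype_iff_of_support_subset fun n hn ↦
    (atomSizes_nonneg n).lt_of_ne (Ne.symm hn)).1 h1

end AtomSizes

/-! ### Invariance under isomorphism -/

section Invariance

variable {B C : Type u} [ProbabilityAlgebra B] [ProbabilityAlgebra C]

theorem Isomorphic.symm (h : Isomorphic B C) : Isomorphic C B := by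
  obtain ⟨e, he⟩ := h
  exact ⟨e.symm, fun c ↦ by rw [← he, e.apply_symm_apply]⟩

theorem eltDensity_map_le {e : B ≃o C} (he : ∀ a, μ (e a) = μ a) (b : B) :
    eltDensity (e b) ≤ eltDensity b := by
  have hiso : Isometry e := Isometry.of_dist_eq fun x y ↦ by
    simp only [dist_eq_sub, ms_eq_μ, ← e.map_sup, ← e.map_inf, he]
  exact density_le_of_surjective
    (f := fun x : Set.Iic b ↦ (⟨e x.1, e.monotone x.2⟩ : Set.Iic (e b)))
    ((hiso.continuous.comp continuous_subtype_val).subtype_mk _)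
    fun y ↦ ⟨⟨e.symm y.1, (e.symm_apply_le).2 y.2⟩, Subtype.ext (e.apply_symm_apply _)⟩

theorem eltDensity_map {e : B ≃o C} (he : ∀ a, μ (e a) = μ a) (b : B) :
    eltDensity (e b) = eltDensity b := by
  refine (eltDensity_map_le he b).antisymm ?_
  have := eltDensity_map_le (e := e.symm) (fun c ↦ by rw [← he, e.apply_symm_apply]) (e b)
  rwa [e.symm_apply_apply] at this

/-- This set carries both Maharam invariants: its supremum is `maharamΨ`, and its nonemptiness for
infinite `κ` is membership in `maharamK`. -/
theorem Isomorphic.homogeneousMeasures_subset (h : Isomorphic B C) (κ : Cardinal.{u}) :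
    homogeneousMeasures B κ ⊆ homogeneousMeasures C κ := by
  obtain ⟨e, he⟩ := h
  rintro _ ⟨b, h1, h2, rfl, rfl⟩
  refine ⟨e b, isAtomless_of_forall_not_isAtom fun a ha hatom ↦ ?_, ⟨?_, fun a ha ha0 ↦ ?_⟩,
    eltDensity_map he b, he b⟩
  · exact h1.not_isAtom ((e.symm_apply_le).2 ha) ((e.symm.isAtom_iff a).2 hatom)
  · exact fun h ↦ h2.1 ((map_eq_bot_iff e).1 h)
  · have h3 := eltDensity_map he (e.symm a)
    rw [e.apply_symm_apply] at h3
    rw [h3, eltDensity_map he b]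
    exact h2.2 _ ((e.symm_apply_le).2 ha) fun h ↦ ha0 ((map_eq_bot_iff e.symm).1 h)

theorem Isomorphic.homogeneousMeasures_eq (h : Isomorphic B C) :
    homogeneousMeasures B = homogeneousMeasures C :=
  funext fun κ ↦ (h.homogeneousMeasures_subset κ).antisymm (h.symm.homogeneousMeasures_subset κ)

theorem Isomorphic.maharamΨ_eq (h : Isomorphic B C) : maharamΨ B = maharamΨ C := by
  unfold maharamΨ
  rw [h.homogeneousMeasures_eq]

variable (B) in
theorem mem_maharamK_iff {κ : Cardinal.{u}} :
    κ ∈ maharamK B ↔ ℵ₀ ≤ κ ∧ (homogeneousMeasures B κ).Nonempty := by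
  refine and_congr_right fun _ ↦ ⟨?_, ?_⟩
  · rintro ⟨b, h1, h2, h3⟩
    exact ⟨_, b, h1, h2, h3, rfl⟩
  · rintro ⟨_, b, h1, h2, h3, _⟩
    exact ⟨b, h1, h2, h3⟩

theorem Isomorphic.maharamK_eq (h : Isomorphic B C) : maharamK B = maharamK C := by
  ext κ
  rw [mem_maharamK_iff, mem_maharamK_iff, h.homogeneousMeasures_eq]

theorem Isomorphic.atomSizes_le (h : Isomorphic B C) (n : ℕ) : atomSizes B n ≤ atomSizes C n := by
  obtain ⟨e, he⟩ := h
  refine csSup_le_csSup (bddAbove_atomSizes n) (Set.insert_nonempty _ _)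
    (Set.insert_subset_insert ?_)
  rintro r ⟨s, hs, h⟩
  refine ⟨s.map e.toEmbedding, by rwa [Finset.card_map], fun c hc ↦ ?_⟩
  obtain ⟨b, hb, rfl⟩ := Finset.mem_map.1 hc
  exact ⟨(e.isAtom_iff b).2 (h b hb).1, (h b hb).2.trans (he b).ge⟩

theorem Isomorphic.atomSizes_eq (h : Isomorphic B C) : atomSizes B = atomSizes C :=
  funext fun n ↦ (h.atomSizes_le n).antisymm (h.symm.atomSizes_le n)

end Invariance

/-! ### Classification by the invariants -/

section Classification

variable {B C : Type u} [ProbabilityAlgebra B] [ProbabilityAlgebra C]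

theorem isomorphic_of_ms (h : ∃ e : B ≃o C, ∀ b, ms (e b) = ms b) : Isomorphic B C := by
  obtain ⟨e, he⟩ := h
  exact ⟨e, fun b ↦ by rw [← ms_eq_μ, he, ms_eq_μ]⟩

theorem exists_orderIso_Iic_of_isAtom {b : B} {c : C} (hb : IsAtom b) (hc : IsAtom c)
    (h : μ b = μ c) : ∃ e : Set.Iic b ≃o Set.Iic c, ∀ x, ms (e x : C) = ms (x : B) := by
  classical
  have := Set.isSimpleOrder_Iic_iff_isAtom.2 hb
  have := Set.isSimpleOrder_Iic_iff_isAtom.2 hc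
  refine ⟨(IsSimpleOrder.orderIsoBool (α := Set.Iic b)).trans
    (IsSimpleOrder.orderIsoBool (α := Set.Iic c)).symm, fun x ↦ ?_⟩
  rcases eq_bot_or_eq_top x with rfl | rfl
  · rw [OrderIso.map_bot]
    exact ms_bot.trans ms_bot.symm
  · rw [OrderIso.map_top]
    change ms c = ms b
    rw [ms_eq_μ, ms_eq_μ, h]

/-- The pieces of the Maharam decomposition: the atoms and the homogeneous parts. -/
noncomputable def piece {J K : Type*} (eJ : J ≃ {a : B // IsAtom a}) (eK : K ≃ maharamK B) :
    J ⊕ K → B :=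
  Sum.elim (fun j ↦ (eJ j).1) fun k ↦ homogeneousPart B (eK k)

theorem pairwise_disjoint_piece {J K : Type*} (eJ : J ≃ {a : B // IsAtom a})
    (eK : K ≃ maharamK B) : Pairwise (Function.onFun Disjoint (piece eJ eK)) := by
  rintro (i | i) (j | j) hij
  · exact pairwise_disjoint_atoms fun h ↦ hij (congrArg _ (eJ.injective h))
  · exact ((isAtomless_homogeneousPart _).disjoint_atom (eJ i).2).symm
  · exact (isAtomless_homogeneousPart _).disjoint_atom (eJ j).2
  · exact pairwise_disjoint_homogeneousPart fun h ↦ hij (congrArg _ (eK.injective h))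

theorem isLUB_range_piece {J K : Type*} (eJ : J ≃ {a : B // IsAtom a})
    (eK : K ≃ maharamK B) : IsLUB (Set.range (piece eJ eK)) ⊤ := by
  refine ⟨fun _ _ ↦ le_top, fun u hu ↦ ?_⟩
  rw [← sup_compl_eq_top (x := atomicPart B)]
  refine sup_le (isLUB_range_atoms.2 ?_) (isLUB_range_homogeneousPart.2 ?_)
  · rintro _ ⟨a, rfl⟩
    exact hu ⟨.inl (eJ.symm a), by simp [piece]⟩
  · rintro _ ⟨κ, rfl⟩
    exact hu ⟨.inr (eK.symm κ), by simp [piece]⟩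

theorem isomorphic_of_invariants (h1 : atomSizes B = atomSizes C) (h2 : maharamK B = maharamK C)
    (h3 : ∀ κ ∈ maharamK B, maharamΨ B κ = maharamΨ C κ) : Isomorphic B C := by
  obtain ⟨e, he⟩ := exists_equiv_atoms B
  obtain ⟨f, hf⟩ := exists_equiv_atoms C
  -- Both partitions must share an index type: positions of positive atom sizes for the atoms,
  -- elements of `maharamK B` for the homogeneous parts.
  let t : {n // 0 < atomSizes B n} ≃ {n // 0 < atomSizes C n} :=
    Equiv.subtypeEquivRight fun n ↦ by rw [h1]
  refine isomorphic_of_ms (exists_orderIso_of_partition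
    (pairwise_disjoint_piece e (Equiv.refl _)) (isLUB_range_piece e (Equiv.refl _))
    (pairwise_disjoint_piece (t.trans f) (Equiv.setCongr h2))
    (isLUB_range_piece (t.trans f) (Equiv.setCongr h2)) ?_)
  rintro (n | ⟨κ, hκ⟩)
  · refine exists_orderIso_Iic_of_isAtom (e n).2 (f (t n)).2 ?_
    change μ (e n).1 = μ (f (t n)).1
    rw [he, hf]
    exact congrFun h1 n
  · have hκ' : κ ∈ maharamK C := h2 ▸ hκ
    refine exists_orderIso_Iic hκ.1 (fun x hx hx0 ↦ eltDensity_of_le_homogeneousPart hκ hx hx0)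
      (fun x hx hx0 ↦ eltDensity_of_le_homogeneousPart hκ' hx hx0) (homogeneousPart_ne_bot hκ)
      (homogeneousPart_ne_bot hκ') ?_
    change ms (homogeneousPart B κ) = ms (homogeneousPart C κ)
    rw [ms_eq_μ, ms_eq_μ, ← maharamΨ_eq hκ, ← maharamΨ_eq hκ', h3 κ hκ]

variable (B) in
theorem eltDensity_top : eltDensity (⊤ : B) = density B := by
  refine le_antisymm ?_ ?_
  · exact density_le_of_surjective (f := fun x : B ↦ (⟨x, le_top⟩ : Set.Iic (⊤ : B)))
      (continuous_id.subtype_mk _) fun x ↦ ⟨x.1, rfl⟩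
  · exact density_le_of_surjective (f := fun x : Set.Iic (⊤ : B) ↦ x.1)
      continuous_subtype_val fun x ↦ ⟨⟨x, le_top⟩, rfl⟩

theorem isomorphic_of_isHomogeneous (hB : IsAtomless (⊤ : B)) (hB' : IsHomogeneous (⊤ : B))
    (hC' : IsHomogeneous (⊤ : C)) (h : density B = density C) : Isomorphic B C := by
  refine isomorphic_of_ms (exists_orderIso_of_homogeneous (κ := density B) ?_ (fun a ha ↦ ?_)
    (fun c hc ↦ ?_) le_rfl h.ge ?_)
  · rw [← eltDensity_top]
    exact hB.aleph0_le_eltDensity hB'.1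
  · rw [← eltDensity_top]
    exact (hB'.2 a le_top ha).ge
  · rw [h, ← eltDensity_top]
    exact (hC'.2 c le_top hc).ge
  · rw [ms_eq_μ, ms_eq_μ, μ_top, μ_top]

end Classification

end ProbabilityAlgebra

theorem theorem7 :
    -- the invariants of a probability algebra have the stated form
    (∀ (B : Type u) [ProbabilityAlgebra B],
      (maharamK B).Countable ∧
      (∀ κ ∈ maharamK B, maharamΨ B κ ∈ Set.Ioc (0 : ℝ) 1) ∧
      ∃ a₀ : B, IsAtomicPart a₀ ∧
        HasSum (fun n : ℕ => atomSizes B n) (μ a₀) ∧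
        HasSum (fun κ : maharamK B => maharamΨ B κ) (μ a₀ᶜ)) ∧
    -- the invariants determine the algebra up to isomorphism (and are invariants)
    (∀ (B C : Type u) [ProbabilityAlgebra B] [ProbabilityAlgebra C],
      Isomorphic B C ↔
        atomSizes B = atomSizes C ∧
        maharamK B = maharamK C ∧
        ∀ κ ∈ maharamK B, maharamΨ B κ = maharamΨ C κ) ∧
    -- homogeneous atomless probability algebras are determined by their density
    (∀ (B C : Type u) [ProbabilityAlgebra B] [ProbabilityAlgebra C],
      IsAtomless (⊤ : B) → IsHomogeneous (⊤ : B) →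
      IsAtomless (⊤ : C) → IsHomogeneous (⊤ : C) →
      density B = density C → Isomorphic B C) := by
  refine ⟨fun B _ ↦ ⟨countable_maharamK B, fun κ hκ ↦ maharamΨ_mem_Ioc hκ, atomicPart B,
    isAtomicPart_atomicPart, hasSum_atomSizes B, hasSum_maharamΨ⟩, fun B C _ _ ↦ ⟨fun h ↦ ?_, ?_⟩,
    fun B C _ _ hB hB' _ hC' h ↦ isomorphic_of_isHomogeneous hB hB' hC' h⟩
  · exact ⟨h.atomSizes_eq, h.maharamK_eq, fun κ _ ↦ congrFun h.maharamΨ_eq κ⟩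
  · exact fun ⟨h1, h2, h3⟩ ↦ isomorphic_of_invariants h1 h2 h3
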